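/- Let $\mu$ be Lebesgue measure on the Borel $\sigma$-algebra $\mathcal B$ of $[0,1]$, and let $\mathrm{Aut}([0,1],\mathcal B,\mu)$ be the set of invertible $\mu$-preserving transformations $T:[0,1]\to[0,1]$, where transformations that agree $\mu$-almost everywhere are identified, endowed with the weak topology, i.e. the coarsest topology for which $T\mapsto f\circ T\in L^2(\mu)$ is norm-continuous for every $f\in L^2(\mu)$. Let $(m_k)_{k\in\mathbb N}$ be a strictly increasing sequence in $\mathbb N$ and let $\lambda\in[0,1]$. Then the set of all $T\in\mathrm{Aut}([0,1],\mathcal B,\mu)$ for which there exists a strictly increasing sequence $(k_\ell)_{\ell\in\mathbb N}$ in $\mathbb N$ such that for all $A,B\in\mathcal B$, $$\lim_{\ell\to\infty}\mu(A\cap T^{-m_{k_\ell}}B)=(1-\lambda)\mu(A\cap B)+\lambda\,\mu(A)\mu(B),$$ is a dense $G_\delta$ subset of $\mathrm{Aut}([0,1],\mathcal B,\mu)$. -/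

import Mathlib

open MeasureTheory Filter Topology

noncomputable section

/-- An everywhere defined invertible bi-measurable transformation of `α` preserving `μ`. -/
structure InvertibleMPT {α : Type*} [MeasurableSpace α] (μ : Measure α) where
  toEquiv : α ≃ᵐ α
  measurePreserving : MeasurePreserving toEquiv μ μ

namespace InvertibleMPT

variable {α : Type*} [MeasurableSpace α] {μ : Measure α}

/-- Two transformations are identified when they agree almost everywhere. -/
def aeSetoid (μ : Measure α) : Setoid (InvertibleMPT μ) where
  r T S := T.toEquiv =ᵐ[μ] S.toEquiv
  iseqv := ⟨fun _ => ae_eq_refl _, fun h => h.symm, fun h h' => h.trans h'⟩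

theorem iterate_ae_eq {T S : InvertibleMPT μ} (h : T.toEquiv =ᵐ[μ] S.toEquiv) (n : ℕ) :
    (T.toEquiv)^[n] =ᵐ[μ] (S.toEquiv)^[n] := by
  induction n with
  | zero => exact ae_eq_refl _
  | succ n ih =>
    have h1 := T.measurePreserving.quasiMeasurePreserving.ae_eq_comp ih
    filter_upwards [h1, h] with x hx hx'
    simp only [Function.comp_apply] at hx
    rw [Function.iterate_succ_apply, Function.iterate_succ_apply, hx, hx']

end InvertibleMPT

/-- `Aut(α, μ)`: the invertible measure preserving transformations modulo null sets. -/
def MeasureAut {α : Type*} [MeasurableSpace α] (μ : Measure α) : Type _ :=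
  Quotient (InvertibleMPT.aeSetoid μ)

namespace MeasureAut

variable {α : Type*} [MeasurableSpace α] {μ : Measure α}

/-- The class of a transformation in `Aut(α, μ)`. -/
def mk (T : InvertibleMPT μ) : MeasureAut μ :=
  Quotient.mk (InvertibleMPT.aeSetoid μ) T

/-- The Koopman operator `f ↦ f ∘ T` on `L²(μ)`. -/
def koopman (T : MeasureAut μ) : Lp ℂ 2 μ → Lp ℂ 2 μ :=
  Quotient.lift
    (fun S : InvertibleMPT μ => fun f : Lp ℂ 2 μ =>
      Lp.compMeasurePreserving S.toEquiv S.measurePreserving f)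
    (by
      intro S S' h
      funext f
      apply Lp.ext
      have h' : S.toEquiv =ᵐ[μ] S'.toEquiv := h
      filter_upwards [Lp.coeFn_compMeasurePreserving f S.measurePreserving,
        Lp.coeFn_compMeasurePreserving f S'.measurePreserving, h'] with x h1 h2 h3
      rw [h1, h2, Function.comp_apply, Function.comp_apply, h3]) T

/-- The weak topology on `Aut(α, μ)`: the coarsest topology for which `T ↦ f ∘ T` is continuous
into `L²(μ)` with its norm, for every `f ∈ L²(μ)`. -/
instance weakTopology : TopologicalSpace (MeasureAut μ) :=
  TopologicalSpace.induced (fun T : MeasureAut μ => T.koopman) Pi.topologicalSpace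

/-- The correlation `μ(A ∩ T⁻ⁿB)`. -/
def correlation (T : MeasureAut μ) (n : ℕ) (A B : Set α) : ℝ :=
  Quotient.lift
    (fun S : InvertibleMPT μ => μ.real (A ∩ (S.toEquiv)^[n] ⁻¹' B))
    (by
      intro S S' h
      refine congrArg ENNReal.toReal (measure_congr ?_)
      filter_upwards [InvertibleMPT.iterate_ae_eq h n] with x hx
      exact congrArg (fun y => x ∈ A ∧ y ∈ B) hx |>.trans rfl) T

@[simp]
theorem correlation_mk (S : InvertibleMPT μ) (n : ℕ) (A B : Set α) :
    (mk S).correlation n A B = μ.real (A ∩ (S.toEquiv)^[n] ⁻¹' B) := rfl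

@[simp]
theorem koopman_mk (S : InvertibleMPT μ) (f : Lp ℂ 2 μ) :
    (mk S).koopman f = Lp.compMeasurePreserving S.toEquiv S.measurePreserving f := rfl

/-- The set of `T ∈ Aut(α, μ)` such that, along some subsequence of `(m k)`,
`μ(A ∩ T^{-m}B) → (1 - c) μ(A ∩ B) + c μ(A) μ(B)` for all measurable `A, B`. -/
def interpolatingSet (μ : Measure α) (m : ℕ → ℕ) (c : ℝ) : Set (MeasureAut μ) :=
  {T | ∃ k : ℕ → ℕ, StrictMono k ∧
    ∀ A B : Set α, MeasurableSet A → MeasurableSet B →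
      Tendsto (fun l => T.correlation (m (k l)) A B) atTop
        (𝓝 ((1 - c) * μ.real (A ∩ B) + c * (μ.real A * μ.real B)))}

end MeasureAut

end

/-! The defining condition says that along a subsequence the Koopman powers `T.unitary^[m k]`
converge in the weak operator topology to (1 - λ)I + λP, where P is the projection onto the
constants. The operators involved are uniformly bounded, so dyadic cells suffice as test sets. Hence
the set is a countable intersection of the open sets ⋃_{k ≥ k₀} `approxInterpolating (m k) λ N`
(`interpolatingSet_eq_iInter`), which is the G_δ part. The group is completely metrizable
(`baireSpace_unitInterval`), so by Baire's theorem it remains to see that each union is dense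
(`dense_iUnion_approxInterpolating`).

For density, fix T₀ and a fine grid of K cells. For every large m one needs T whose transition
matrix on the grid is nearly that of T₀ and whose m-th power is nearly the mixture
(`exists_correlation_approx`). After scaling by K the matrix of T₀ is doubly stochastic, hence by
Birkhoff a convex combination of permutation matrices. Running along orbits of these permutations
gives a word w of period q, with equidistributed letters, whose consecutive pairs have nearly the
required frequencies (`exists_word`).

Label columns by w and close each column up into a cycle of length m + c with 0 ≤ c < q. One step
reads consecutive letters, while the m-th power moves down by c. If c = 0 the label returns; if c is
uniform over a period, the label after m steps is independent of the initial one. Using uniform c in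
a proportion λ of the columns and c = 0 in the others yields the mixture, up to boundary effects of
order q/m and the rounding of λ (`exists_perm`). The resulting finite permutation is realized by
translating equal subintervals (`exists_correlation_eq`). -/

open scoped InnerProductSpace

/-! ### Weak operator convergence tested on total sets. -/

section WeakConvergence

variable {H : Type*} [NormedAddCommGroup H] [InnerProductSpace ℂ H] {ι : Type*} {l : Filter ι}

/-- For a bounded family of vectors, the vectors against which it tends weakly to zero form a
closed subspace. -/
theorem tendsto_inner_zero_of_mem_closure {v : ι → H} {C : ℝ} (hv : ∀ x, ‖v x‖ ≤ C) {s : Set H}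
    (hs : ∀ f ∈ s, Tendsto (fun x => ⟪f, v x⟫_ℂ) l (𝓝 0)) {f : H}
    (hf : f ∈ (Submodule.span ℂ s).topologicalClosure) :
    Tendsto (fun x => ⟪f, v x⟫_ℂ) l (𝓝 0) := by
  have hspan : ∀ f ∈ Submodule.span ℂ s, Tendsto (fun x => ⟪f, v x⟫_ℂ) l (𝓝 0) := by
    intro f hf
    induction hf using Submodule.span_induction with
    | mem f h => exact hs f h
    | zero => simpa using tendsto_const_nhds
    | add f g _ _ hf hg => simpa [inner_add_left] using hf.add hg
    | smul a f _ hf => simpa [inner_smul_left, mul_comm] using hf.const_mul ((starRingEnd ℂ) a)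
  rw [Metric.tendsto_nhds]
  intro ε hε
  have hC : 0 < |C| + 1 := by positivity
  obtain ⟨g, hg, hfg⟩ := Metric.mem_closure_iff.1 hf (ε / 2 / (|C| + 1)) (by positivity)
  filter_upwards [Metric.tendsto_nhds.1 (hspan g hg) (ε / 2) (half_pos hε)] with x hx
  rw [dist_zero_right] at hx ⊢
  have h1 : ⟪f, v x⟫_ℂ = ⟪f - g, v x⟫_ℂ + ⟪g, v x⟫_ℂ := by rw [← inner_add_left]; simp
  have h2 : ‖⟪f - g, v x⟫_ℂ‖ ≤ ε / 2 := by
    calc ‖⟪f - g, v x⟫_ℂ‖ ≤ ‖f - g‖ * ‖v x‖ := norm_inner_le_norm _ _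
      _ ≤ ε / 2 / (|C| + 1) * (|C| + 1) := by
          rw [← dist_eq_norm]
          exact mul_le_mul hfg.le ((hv x).trans ((le_abs_self C).trans (by linarith)))
            (norm_nonneg _) (by positivity)
      _ = ε / 2 := by field_simp
  rw [h1]
  exact (norm_add_le _ _).trans_lt (by linarith)

/-- Weak operator convergence to zero of a bounded family can be tested on a total set. -/
theorem tendsto_inner_apply_zero_of_span_dense {D : ι → H →ₗ[ℂ] H} {C : ℝ}
    (hD : ∀ x f, ‖D x f‖ ≤ C * ‖f‖) {s : Set H}
    (hs : (Submodule.span ℂ s).topologicalClosure = ⊤)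
    (h : ∀ e ∈ s, ∀ e' ∈ s, Tendsto (fun x => ⟪e, D x e'⟫_ℂ) l (𝓝 0)) (f g : H) :
    Tendsto (fun x => ⟪f, D x g⟫_ℂ) l (𝓝 0) := by
  have h1 : ∀ e' ∈ s, ∀ f, Tendsto (fun x => ⟪f, D x e'⟫_ℂ) l (𝓝 0) := fun e' he' f =>
    tendsto_inner_zero_of_mem_closure (fun x => hD x e') (fun e he => h e he e' he') (hs ▸ trivial)
  have h2 : ∀ g ∈ Submodule.span ℂ s, ∀ f, Tendsto (fun x => ⟪f, D x g⟫_ℂ) l (𝓝 0) := by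
    intro g hg f
    induction hg using Submodule.span_induction with
    | mem g hg => exact h1 g hg f
    | zero => simpa using tendsto_const_nhds
    | add a b _ _ ha hb => simpa [inner_add_right] using ha.add hb
    | smul c a _ ha => simpa [inner_smul_right] using ha.const_mul c
  rw [Metric.tendsto_nhds]
  intro ε hε
  have hC : 0 < |C| + 1 := by positivity
  have hf : 0 < ‖f‖ + 1 := by positivity
  have hg : g ∈ (Submodule.span ℂ s).topologicalClosure := hs ▸ trivial
  obtain ⟨g', hg', hgg⟩ := Metric.mem_closure_iff.1 hg (ε / 2 / (|C| + 1) / (‖f‖ + 1))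
    (by positivity)
  filter_upwards [Metric.tendsto_nhds.1 (h2 g' hg' f) (ε / 2) (half_pos hε)] with x hx
  rw [dist_zero_right] at hx ⊢
  have e1 : ⟪f, D x g⟫_ℂ = ⟪f, D x (g - g')⟫_ℂ + ⟪f, D x g'⟫_ℂ := by
    rw [← inner_add_right, ← map_add]; simp
  have e2 : ‖⟪f, D x (g - g')⟫_ℂ‖ ≤ ε / 2 := by
    have h3 : ‖D x (g - g')‖ ≤ (|C| + 1) * (ε / 2 / (|C| + 1) / (‖f‖ + 1)) := by
      refine (hD x _).trans ?_
      rw [← dist_eq_norm]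
      exact mul_le_mul ((le_abs_self C).trans (by linarith)) hgg.le dist_nonneg hC.le
    calc ‖⟪f, D x (g - g')⟫_ℂ‖ ≤ ‖f‖ * ‖D x (g - g')‖ := norm_inner_le_norm _ _
      _ ≤ (‖f‖ + 1) * ((|C| + 1) * (ε / 2 / (|C| + 1) / (‖f‖ + 1))) :=
          mul_le_mul (by linarith) h3 (norm_nonneg _) hf.le
      _ = ε / 2 := by field_simp
  rw [e1]
  exact (norm_add_le _ _).trans_lt (by linarith)

/-- Isometries converging weakly at `f` converge strongly at `f`. -/
theorem tendsto_of_tendsto_inner {v : ι → H} {w : H} (hv : ∀ x, ‖v x‖ = ‖w‖)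
    (h : Tendsto (fun x => ⟪w, v x⟫_ℂ) l (𝓝 ⟪w, w⟫_ℂ)) : Tendsto v l (𝓝 w) := by
  rw [tendsto_iff_norm_sub_tendsto_zero]
  -- Since the norms agree, ‖v - w‖² = 2(‖w‖² - Re⟪w, v⟫), which weak convergence sends to zero.
  have h1 : ∀ x, ‖v x - w‖ = √(2 * (‖w‖ ^ 2 - (⟪w, v x⟫_ℂ).re)) := by
    intro x
    rw [← Real.sqrt_sq (norm_nonneg (v x - w)), @norm_sub_sq ℂ, hv x, ← inner_re_symm]
    congr 1
    simp only [RCLike.re_to_complex]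
    ring
  simp only [h1]
  have h2 : Tendsto (fun x => (⟪w, v x⟫_ℂ).re) l (𝓝 (‖w‖ ^ 2)) := by
    have h3 := (Complex.continuous_re.tendsto _).comp h
    have h4 : (⟪w, w⟫_ℂ).re = ‖w‖ ^ 2 := inner_self_eq_norm_sq (𝕜 := ℂ) w
    rwa [h4] at h3
  have h3 := ((tendsto_const_nhds (x := ‖w‖ ^ 2)).sub h2).const_mul 2
  have h4 := (Real.continuous_sqrt.tendsto _).comp h3
  rw [sub_self, mul_zero, Real.sqrt_zero] at h4
  exact h4

end WeakConvergence

/-! ### Koopman operators as unitaries, and their continuity in the weak topology. -/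

namespace MeasureAut

variable {α : Type*} [MeasurableSpace α] {μ : Measure α}

/-- A representative of a class of transformations. -/
noncomputable def rep (T : MeasureAut μ) : InvertibleMPT μ :=
  Quotient.out (s := InvertibleMPT.aeSetoid μ) T

theorem mk_rep (T : MeasureAut μ) : mk T.rep = T :=
  Quotient.out_eq (s := InvertibleMPT.aeSetoid μ) T

theorem measurePreserving_rep_symm (T : MeasureAut μ) :
    MeasurePreserving T.rep.toEquiv.symm μ μ :=
  T.rep.measurePreserving.symm

/-- The Koopman operator as a unitary operator. -/
noncomputable def unitary (T : MeasureAut μ) : Lp ℂ 2 μ ≃ₗᵢ[ℂ] Lp ℂ 2 μ :=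
  { Lp.compMeasurePreservingₗᵢ ℂ T.rep.toEquiv T.rep.measurePreserving with
    invFun := Lp.compMeasurePreserving T.rep.toEquiv.symm T.measurePreserving_rep_symm
    left_inv := fun f => by
      change Lp.compMeasurePreserving T.rep.toEquiv.symm T.measurePreserving_rep_symm
        (Lp.compMeasurePreserving T.rep.toEquiv T.rep.measurePreserving f) = f
      rw [← Lp.compMeasurePreserving_comp_apply]
      simp
    right_inv := fun f => by
      change Lp.compMeasurePreserving T.rep.toEquiv T.rep.measurePreserving
        (Lp.compMeasurePreserving T.rep.toEquiv.symm T.measurePreserving_rep_symm f) = f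
      rw [← Lp.compMeasurePreserving_comp_apply]
      simp }

theorem unitary_apply (T : MeasureAut μ) (f : Lp ℂ 2 μ) :
    T.unitary f = Lp.compMeasurePreserving T.rep.toEquiv T.rep.measurePreserving f := rfl

theorem unitary_symm_apply (T : MeasureAut μ) (f : Lp ℂ 2 μ) :
    T.unitary.symm f =
      Lp.compMeasurePreserving T.rep.toEquiv.symm T.measurePreserving_rep_symm f := rfl

theorem koopman_eq (T : MeasureAut μ) : T.koopman = T.unitary := by
  conv_lhs => rw [← mk_rep T]
  rfl

/-- The n-th Koopman power sends the indicator of B to that of T⁻ⁿB. This turns statements about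
sets into statements about matrix coefficients. -/
theorem correlation_eq_inner [IsFiniteMeasure μ] (T : MeasureAut μ) (n : ℕ) {A B : Set α}
    (hA : MeasurableSet A) (hB : MeasurableSet B) :
    ((T.correlation n A B : ℝ) : ℂ) =
      ⟪indicatorConstLp 2 hA (measure_ne_top μ A) (1 : ℂ),
        T.unitary^[n] (indicatorConstLp 2 hB (measure_ne_top μ B) (1 : ℂ))⟫_ℂ := by
  have h1 : T.unitary^[n] (indicatorConstLp 2 hB (measure_ne_top μ B) (1 : ℂ)) =
      indicatorConstLp 2 ((T.rep.measurePreserving.iterate n).measurable hB)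
        (measure_ne_top μ _) (1 : ℂ) := by
    have h2 := Lp.compMeasurePreserving_iterate (E := ℂ) (p := 2) T.rep.measurePreserving n
    have h3 := congrArg
      (fun F => F (indicatorConstLp 2 hB (measure_ne_top μ B) (1 : ℂ))) h2
    simp only [Lp.indicatorConstLp_compMeasurePreserving] at h3
    rw [← h3]
    rfl
  rw [h1, L2.inner_indicatorConstLp_one_indicatorConstLp_one]
  conv_lhs => rw [← mk_rep T]
  rfl

theorem continuous_unitary_apply (f : Lp ℂ 2 μ) :
    Continuous fun T : MeasureAut μ => T.unitary f := by
  have h : Continuous fun T : MeasureAut μ => T.koopman :=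
    continuous_induced_dom
  simpa [koopman_eq] using (continuous_pi_iff.1 h) f

/-- Isometries are equicontinuous, so the argument may vary with the operator. -/
theorem tendsto_unitary_apply {ι : Type*} {l : Filter ι} {T : ι → MeasureAut μ}
    {U : Lp ℂ 2 μ → Lp ℂ 2 μ} (hT : ∀ f, Tendsto (fun x => (T x).unitary f) l (𝓝 (U f)))
    {v : ι → Lp ℂ 2 μ} {w : Lp ℂ 2 μ} (hv : Tendsto v l (𝓝 w)) :
    Tendsto (fun x => (T x).unitary (v x)) l (𝓝 (U w)) := by
  refine (hT w).congr_dist ?_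
  have h1 : ∀ x, dist ((T x).unitary w) ((T x).unitary (v x)) = dist (v x) w := by
    intro x
    rw [(T x).unitary.dist_map, dist_comm]
  simpa [h1] using tendsto_iff_dist_tendsto_zero.1 hv

theorem continuous_unitary_iterate (n : ℕ) (f : Lp ℂ 2 μ) :
    Continuous fun T : MeasureAut μ => T.unitary^[n] f := by
  induction n with
  | zero => simpa using continuous_const
  | succ n ih =>
    rw [continuous_iff_continuousAt]
    intro T
    simp only [Function.iterate_succ_apply']
    exact tendsto_unitary_apply (U := T.unitary)
      (fun f => (continuous_unitary_apply f).tendsto T) (ih.tendsto T)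

theorem continuous_unitary_symm_apply (f : Lp ℂ 2 μ) :
    Continuous fun T : MeasureAut μ => T.unitary.symm f := by
  rw [continuous_iff_continuousAt]
  intro T
  rw [ContinuousAt, tendsto_iff_dist_tendsto_zero]
  -- Applying the isometry S to both terms moves the question to S alone, at the fixed vector T⁻¹f.
  have h1 : ∀ S : MeasureAut μ, dist (S.unitary.symm f) (T.unitary.symm f) =
      dist (S.unitary (T.unitary.symm f)) f := by
    intro S
    rw [← S.unitary.dist_map, LinearIsometryEquiv.apply_symm_apply, dist_comm]
  simp only [h1]
  have h2 := (continuous_unitary_apply (T.unitary.symm f)).tendsto T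
  rw [LinearIsometryEquiv.apply_symm_apply] at h2
  exact tendsto_iff_dist_tendsto_zero.1 h2

theorem continuous_correlation [IsFiniteMeasure μ] (n : ℕ) {A B : Set α}
    (hA : MeasurableSet A) (hB : MeasurableSet B) :
    Continuous fun T : MeasureAut μ => T.correlation n A B := by
  have h : Continuous fun T : MeasureAut μ => ((T.correlation n A B : ℝ) : ℂ) := by
    simp only [correlation_eq_inner _ n hA hB]
    exact continuous_const.inner (continuous_unitary_iterate n _)
  exact Complex.continuous_re.comp h

/-- Convergence in the weak topology can be tested by the matrix coefficients of the Koopman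
operators on a total set. -/
theorem tendsto_of_tendsto_inner {ι : Type*} {l : Filter ι} {T : ι → MeasureAut μ}
    {T₀ : MeasureAut μ} {s : Set (Lp ℂ 2 μ)}
    (hs : (Submodule.span ℂ s).topologicalClosure = ⊤)
    (h : ∀ e ∈ s, ∀ e' ∈ s,
      Tendsto (fun x => ⟪e, (T x).unitary e'⟫_ℂ) l (𝓝 ⟪e, T₀.unitary e'⟫_ℂ)) :
    Tendsto T l (𝓝 T₀) := by
  have hind : Topology.IsInducing (fun T : MeasureAut μ => T.koopman) := ⟨rfl⟩
  rw [hind.tendsto_nhds_iff, tendsto_pi_nhds]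
  intro f
  simp only [Function.comp_apply, koopman_eq]
  -- All the vectors have the norm of f, so weak convergence at f upgrades to norm convergence.
  refine _root_.tendsto_of_tendsto_inner (fun x => by simp) ?_
  have hD := tendsto_inner_apply_zero_of_span_dense (l := l) (C := 2)
    (D := fun x => (T x).unitary.toLinearEquiv.toLinearMap -
      T₀.unitary.toLinearEquiv.toLinearMap) (fun x f => ?_) hs ?_ (T₀.unitary f) f
  · simp only [LinearMap.sub_apply, inner_sub_right] at hD
    simpa using hD.add_const ⟪T₀.unitary f, T₀.unitary f⟫_ℂ
  · refine (norm_sub_le _ _).trans (le_of_eq ?_)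
    simp
    ring
  · intro e he e' he'
    simp only [LinearMap.sub_apply, inner_sub_right]
    simpa using (h e he e' he').sub_const ⟪e, T₀.unitary e'⟫_ℂ

end MeasureAut

/-! ### Grid cells and the density of dyadic step functions. -/

/-- The points of `[0,1]` whose image under `x ↦ n x` has integer part `i`. -/
def gridCell (n i : ℕ) : Set unitInterval := {x | ⌊(n : ℝ) * x⌋₊ = i}

theorem measurableSet_gridCell (n i : ℕ) : MeasurableSet (gridCell n i) := by
  have h : Measurable fun x : unitInterval => ⌊(n : ℝ) * x⌋₊ :=
    (measurable_subtype_coe.const_mul _).nat_floor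
  exact h (measurableSet_singleton i)

theorem mem_gridCell_iff {n i : ℕ} (hn : 0 < n) {x : unitInterval} :
    x ∈ gridCell n i ↔ (i : ℝ) / n ≤ x ∧ (x : ℝ) < (i + 1) / n := by
  have hn' : (0 : ℝ) < n := by exact_mod_cast hn
  rw [gridCell, Set.mem_ofPred_eq, Nat.floor_eq_iff (mul_nonneg hn'.le x.2.1), div_le_iff₀' hn',
    lt_div_iff₀' hn']

theorem mem_gridCell_iff_floor_div {K L : ℕ} (i : ℕ) (hL : 0 < L) (x : unitInterval) :
    ⌊(K : ℝ) * x⌋₊ = i ↔ ⌊((K * L : ℕ) : ℝ) * x⌋₊ / L = i := by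
  have hL' : (L : ℝ) ≠ 0 := by exact_mod_cast hL.ne'
  rw [← Nat.floor_div_natCast]
  have : ((K * L : ℕ) : ℝ) * x / L = K * x := by
    push_cast
    field_simp
  rw [this]

theorem volume_gridCell {n i : ℕ} (hi : i < n) :
    volume (gridCell n i) = ENNReal.ofReal (1 / n) := by
  have hn : 0 < n := by omega
  have hn' : (0 : ℝ) < n := by exact_mod_cast hn
  have h1 : Subtype.val '' gridCell n i = Set.Ico ((i : ℝ) / n) ((i + 1) / n) := by
    ext x
    simp only [Set.mem_image, Set.mem_Ico]
    constructor
    · rintro ⟨y, hy, rfl⟩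
      exact (mem_gridCell_iff hn).1 hy
    · intro hx
      have hi' : ((i : ℝ) + 1) ≤ n := by exact_mod_cast hi
      refine ⟨⟨x, (by positivity : (0 : ℝ) ≤ i / n).trans hx.1,
        hx.2.le.trans ((div_le_one hn').2 hi')⟩, (mem_gridCell_iff hn).2 hx, rfl⟩
  rw [unitInterval.volume_apply, h1, Real.volume_Ico]
  congr 1
  ring

theorem measureReal_gridCell {n i : ℕ} (hi : i < n) :
    (volume : Measure unitInterval).real (gridCell n i) = 1 / n := by
  rw [Measure.real, volume_gridCell hi, ENNReal.toReal_ofReal (by positivity)]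

theorem disjoint_gridCell (n : ℕ) {i j : ℕ} (h : i ≠ j) :
    Disjoint (gridCell n i) (gridCell n j) := by
  rw [Set.disjoint_left]
  intro x hi hj
  exact h (hi.symm.trans hj)

/-- The endpoint 1 is the only point whose index at mesh 1/n is n rather than smaller; this null
point is discarded throughout. -/
theorem ae_lt_one : ∀ᵐ x : unitInterval, (x : ℝ) < 1 := by
  have h : ∀ᵐ x : unitInterval, x ≠ 1 := by
    rw [ae_iff]
    simp
  filter_upwards [h] with x hx
  exact lt_of_le_of_ne x.2.2 fun h => hx (Subtype.ext h)

theorem floor_lt {n : ℕ} (hn : 0 < n) {x : unitInterval} (hx : (x : ℝ) < 1) :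
    ⌊(n : ℝ) * x⌋₊ < n := by
  have hn' : (0 : ℝ) < n := by exact_mod_cast hn
  rw [Nat.floor_lt (mul_nonneg hn'.le x.2.1)]
  nlinarith

/-- The indicator function of a grid cell in `L²`. -/
noncomputable def cellIndicator (n i : ℕ) : Lp ℂ 2 (volume : Measure unitInterval) :=
  indicatorConstLp 2 (measurableSet_gridCell n i) (measure_ne_top _ _) 1

theorem coeFn_cellIndicator (n i : ℕ) :
    cellIndicator n i =ᵐ[volume] fun x => if ⌊(n : ℝ) * x⌋₊ = i then (1 : ℂ) else 0 := by
  refine indicatorConstLp_coeFn.trans (ae_of_all _ fun x => ?_)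
  simp [Set.indicator_apply, gridCell]

theorem coeFn_sum_smul_cellIndicator (n : ℕ) (s : Finset ℕ) (c : ℕ → ℂ) :
    (∑ i ∈ s, c i • cellIndicator n i : Lp ℂ 2 (volume : Measure unitInterval)) =ᵐ[volume]
      fun x => if ⌊(n : ℝ) * x⌋₊ ∈ s then c ⌊(n : ℝ) * x⌋₊ else 0 := by
  have h1 : ∀ᵐ x : unitInterval, ∀ i : ℕ, (c i • cellIndicator n i :
      Lp ℂ 2 (volume : Measure unitInterval)) x = if ⌊(n : ℝ) * x⌋₊ = i then c i else 0 := by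
    rw [ae_all_iff]
    intro i
    filter_upwards [Lp.coeFn_smul (c i) (cellIndicator n i), coeFn_cellIndicator n i] with x h h'
    rw [h, Pi.smul_apply, h']
    split_ifs <;> simp
  filter_upwards [Lp.coeFn_finsetSum s fun i => c i • cellIndicator n i, h1] with x hx h2
  rw [hx, Finset.sum_apply]
  simp only [h2]
  rw [Finset.sum_ite_eq]

theorem cellIndicator_mul {K L : ℕ} (hK : 0 < K) (hL : 0 < L) (i : ℕ) :
    cellIndicator K i =
      ∑ a ∈ (Finset.range (K * L)).filter (fun a => a / L = i), cellIndicator (K * L) a := by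
  apply Lp.ext
  have h := coeFn_sum_smul_cellIndicator (K * L)
    ((Finset.range (K * L)).filter (fun a => a / L = i)) (fun _ => 1)
  simp only [one_smul] at h
  refine (coeFn_cellIndicator K i).trans (EventuallyEq.trans ?_ h.symm)
  filter_upwards [ae_lt_one] with x hx
  have h1 := floor_lt (Nat.mul_pos hK hL) hx
  simp only [mem_gridCell_iff_floor_div (K := K) i hL x, Finset.mem_filter, Finset.mem_range, h1, true_and]

/-- The indicators of all dyadic cells. -/
def dyadicIndicators : Set (Lp ℂ 2 (volume : Measure unitInterval)) :=
  Set.range fun p : ℕ × ℕ => cellIndicator (2 ^ p.1) p.2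

/-- Continuous functions are dense in L², and uniform continuity makes each of them uniformly close
to a dyadic step function. -/
theorem span_dyadicIndicators_dense :
    (Submodule.span ℂ dyadicIndicators).topologicalClosure = ⊤ := by
  rw [eq_top_iff]
  intro f _
  refine closure_minimal (s := Set.range (ContinuousMap.toLp 2 (volume : Measure unitInterval) ℂ))
    ?_ (Submodule.isClosed_topologicalClosure _)
    (ContinuousMap.toLp_denseRange ℂ (volume : Measure unitInterval) ℂ (by simp) f)
  rintro _ ⟨g, rfl⟩
  change _ ∈ closure _
  rw [Metric.mem_closure_iff]
  intro ε hε
  obtain ⟨δ, hδ, hg⟩ := Metric.uniformContinuous_iff.1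
    (CompactSpace.uniformContinuous_of_continuous g.continuous) (ε / 2) (half_pos hε)
  obtain ⟨M, hM⟩ := exists_pow_lt_of_lt_one hδ (by norm_num : (1 / 2 : ℝ) < 1)
  have hpos : (0 : ℝ) < (2 ^ M : ℕ) := by positivity
  -- Sample g at the left endpoint of each cell; `Set.projIcc` only makes the sample point an
  -- element of the interval.
  let c : ℕ → ℂ := fun i => g (Set.projIcc 0 1 zero_le_one ((i : ℝ) / (2 ^ M : ℕ)))
  refine ⟨∑ i ∈ Finset.range (2 ^ M), c i • cellIndicator (2 ^ M) i, ?_, ?_⟩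
  · exact Submodule.sum_mem _ fun i _ => Submodule.smul_mem _ _
      (Submodule.subset_span ⟨(M, i), rfl⟩)
  · rw [dist_eq_norm]
    refine (Lp.norm_le_of_ae_bound (C := ε / 2) (by positivity) ?_).trans_lt ?_
    · filter_upwards [Lp.coeFn_sub (ContinuousMap.toLp 2 (volume : Measure unitInterval) ℂ g)
        (∑ i ∈ Finset.range (2 ^ M), c i • cellIndicator (2 ^ M) i),
        ContinuousMap.coeFn_toLp (p := 2) (𝕜 := ℂ) (volume : Measure unitInterval) g,
        coeFn_sum_smul_cellIndicator (2 ^ M) (Finset.range (2 ^ M)) c, ae_lt_one]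
        with x h1 h2 h3 h4
      have h5 := floor_lt (n := 2 ^ M) (by positivity) h4
      rw [h1, Pi.sub_apply, h2, h3, if_pos (Finset.mem_range.2 h5), ← dist_eq_norm]
      refine (hg ?_).le
      have h6 : (⌊((2 ^ M : ℕ) : ℝ) * x⌋₊ : ℝ) / (2 ^ M : ℕ) ≤ x := by
        rw [div_le_iff₀' hpos]
        exact Nat.floor_le (mul_nonneg hpos.le x.2.1)
      have h7 : (x : ℝ) < (⌊((2 ^ M : ℕ) : ℝ) * x⌋₊ : ℝ) / (2 ^ M : ℕ) + (1 / 2) ^ M := by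
        have h8 : ((1 : ℝ) / 2) ^ M = 1 / (2 ^ M : ℕ) := by push_cast; rw [div_pow, one_pow]
        rw [h8, ← add_div, lt_div_iff₀' hpos]
        exact Nat.lt_floor_add_one _
      rw [Subtype.dist_eq, Set.projIcc_of_mem zero_le_one
        ⟨by positivity, h6.trans x.2.2⟩, Real.dist_eq, abs_lt]
      constructor <;> simp only <;> linarith
    · simp [measureUnivNNReal]
      linarith

/-! ### Strong limits of composition operators. -/

/-- A sequence of linear isometries converging at the points of a total set converges
everywhere. -/
theorem exists_tendsto_of_span_dense {H : Type*} [NormedAddCommGroup H] [InnerProductSpace ℂ H]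
    [CompleteSpace H] {V : ℕ → H →ₗᵢ[ℂ] H} {s : Set H}
    (hs : (Submodule.span ℂ s).topologicalClosure = ⊤)
    (h : ∀ e ∈ s, ∃ g, Tendsto (fun n => V n e) atTop (𝓝 g)) (f : H) :
    ∃ g, Tendsto (fun n => V n f) atTop (𝓝 g) := by
  have h1 : ∀ f ∈ Submodule.span ℂ s, ∃ g, Tendsto (fun n => V n f) atTop (𝓝 g) := by
    intro f hf
    induction hf using Submodule.span_induction with
    | mem f hf => exact h f hf
    | zero => exact ⟨0, by simp⟩
    | add a b _ _ ha hb =>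
      obtain ⟨a', ha⟩ := ha
      obtain ⟨b', hb⟩ := hb
      exact ⟨a' + b', by simpa using ha.add hb⟩
    | smul c a _ ha =>
      obtain ⟨a', ha⟩ := ha
      exact ⟨c • a', by simpa using ha.const_smul c⟩
  refine cauchySeq_tendsto_of_complete (Metric.cauchySeq_iff'.2 fun ε hε => ?_)
  have hf : f ∈ (Submodule.span ℂ s).topologicalClosure := hs ▸ trivial
  obtain ⟨g, hg, hfg⟩ := Metric.mem_closure_iff.1 hf (ε / 3) (by positivity)
  obtain ⟨g', hg'⟩ := h1 g hg
  obtain ⟨N, hN⟩ := Metric.cauchySeq_iff'.1 hg'.cauchySeq (ε / 3) (by positivity)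
  refine ⟨N, fun n hn => ?_⟩
  have h2 := hN n hn
  have h3 : dist (V n f) (V n g) < ε / 3 := by rwa [(V n).dist_map]
  have h4 : dist (V N g) (V N f) < ε / 3 := by rwa [(V N).dist_map, dist_comm]
  have h5 := dist_triangle4 (V n f) (V n g) (V N g) (V N f)
  linarith

/-- The inclusion of the unit interval into the complex numbers. -/
noncomputable def unitInterval.coord : C(unitInterval, ℂ) :=
  ⟨fun x => ((x : ℝ) : ℂ), by fun_prop⟩

/-- The inclusion of the unit interval into the complex numbers, as a square integrable function. -/
noncomputable def coordLp : Lp ℂ 2 (volume : Measure unitInterval) :=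
  ContinuousMap.toLp 2 volume ℂ unitInterval.coord

theorem coeFn_compMeasurePreserving_toLp {S : unitInterval → unitInterval}
    (hS : MeasurePreserving S volume volume) (g : C(unitInterval, ℂ)) :
    Lp.compMeasurePreserving S hS (ContinuousMap.toLp 2 volume ℂ g) =ᵐ[volume]
      fun x => g (S x) := by
  refine (Lp.coeFn_compMeasurePreserving _ hS).trans ?_
  exact hS.quasiMeasurePreserving.ae_eq_comp (ContinuousMap.coeFn_toLp volume g)

/-- The coordinate function is injective, so this single L² function determines a map modulo null
sets. -/
theorem ae_eq_of_comp_coordLp_eq {S R : unitInterval → unitInterval}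
    (hS : MeasurePreserving S volume volume) (hR : MeasurePreserving R volume volume)
    (h : Lp.compMeasurePreserving S hS coordLp = Lp.compMeasurePreserving R hR coordLp) :
    S =ᵐ[volume] R := by
  have h1 := coeFn_compMeasurePreserving_toLp hS unitInterval.coord
  have h2 := coeFn_compMeasurePreserving_toLp hR unitInterval.coord
  change Lp.compMeasurePreserving S hS coordLp =ᵐ[volume] _ at h1
  rw [h] at h1
  filter_upwards [h1.symm.trans h2] with x hx
  exact Subtype.ext (Complex.ofReal_injective hx)

/-- If the composition operators of measure preserving maps of the unit interval converge
strongly, then the limit is the composition operator of a measure preserving map. -/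
theorem exists_measurePreserving_of_tendsto {S : ℕ → unitInterval → unitInterval}
    (hS : ∀ n, MeasurePreserving (S n) volume volume)
    (h : ∀ f : Lp ℂ 2 (volume : Measure unitInterval),
      ∃ g, Tendsto (fun n => Lp.compMeasurePreserving (S n) (hS n) f) atTop (𝓝 g)) :
    ∃ (R : unitInterval → unitInterval) (hR : MeasurePreserving R volume volume),
      ∀ f : Lp ℂ 2 (volume : Measure unitInterval),
        Tendsto (fun n => Lp.compMeasurePreserving (S n) (hS n) f) atTop
          (𝓝 (Lp.compMeasurePreserving R hR f)) := by
  choose V hV using h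
  -- The limit map is read off from the image of the coordinate function: L² convergence gives
  -- almost everywhere convergence along a subsequence.
  obtain ⟨ns, hns, hae⟩ := (tendstoInMeasure_of_tendsto_Lp (hV coordLp)).exists_seq_tendsto_ae
  let R : unitInterval → unitInterval := fun x =>
    Set.projIcc 0 1 zero_le_one (V coordLp x).re
  have hRm : Measurable R :=
    continuous_projIcc.measurable.comp
      (Complex.measurable_re.comp (Lp.stronglyMeasurable (V coordLp)).measurable)
  have hlim : ∀ᵐ x : unitInterval, Tendsto (fun k => S (ns k) x) atTop (𝓝 (R x)) := by
    have h1 := ae_all_iff.2 fun n => coeFn_compMeasurePreserving_toLp (hS n) unitInterval.coord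
    filter_upwards [hae, h1] with x hx h1
    have h2 := ((continuous_projIcc (h := zero_le_one (α := ℝ))).comp
      Complex.continuous_re).tendsto (V coordLp x)
    refine (h2.comp hx).congr fun k => ?_
    simp only [Function.comp_apply]
    rw [coordLp, h1 (ns k)]
    simp [unitInterval.coord]
  -- Dominated convergence gives ∫ f ∘ R = ∫ f for every bounded continuous f, which identifies the
  -- pushforward measure.
  have hR : MeasurePreserving R volume volume := by
    refine ⟨hRm, ?_⟩
    have : IsFiniteMeasure (Measure.map R volume) := Measure.isFiniteMeasure_map _ _
    refine ext_of_forall_integral_eq_of_IsFiniteMeasure fun f => ?_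
    rw [integral_map hRm.aemeasurable f.continuous.aestronglyMeasurable]
    have h1 : Tendsto (fun k => ∫ x, f (S (ns k) x)) atTop (𝓝 (∫ x, f (R x))) := by
      refine tendsto_integral_of_dominated_convergence (fun _ => ‖f‖) (fun k =>
        (f.continuous.measurable.comp (hS _).measurable).aestronglyMeasurable)
        (integrable_const _) (fun k => ae_of_all _ fun x => f.norm_coe_le_norm _) ?_
      filter_upwards [hlim] with x hx
      exact (f.continuous.tendsto _).comp hx
    have h2 : ∀ k, ∫ x, f (S (ns k) x) = ∫ x, f x := by
      intro k
      rw [← integral_map (hS _).measurable.aemeasurable f.continuous.aestronglyMeasurable,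
        (hS _).map_eq]
    simp only [h2] at h1
    exact tendsto_nhds_unique tendsto_const_nhds h1 |>.symm
  refine ⟨R, hR, ?_⟩
  have hVc : Continuous V := by
    refine (LipschitzWith.of_dist_le_mul (K := 1) fun f g => ?_).continuous
    rw [NNReal.coe_one, one_mul]
    refine le_of_tendsto' ((hV f).dist (hV g)) fun n => ?_
    rw [(Lp.isometry_compMeasurePreserving (hS n)).dist_eq]
  have hfun : V = Lp.compMeasurePreserving R hR := by
    refine (ContinuousMap.toLp_denseRange ℂ (volume : Measure unitInterval) ℂ
      (by simp : (2 : ENNReal) ≠ ⊤)).equalizer hVc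
      (Lp.isometry_compMeasurePreserving hR).continuous ?_
    funext g
    apply Lp.ext
    simp only [Function.comp_apply]
    -- A further subsequence converges almost everywhere both to V g and, by continuity of g, to g ∘
    -- R.
    obtain ⟨ms, hms, hms'⟩ := (tendstoInMeasure_of_tendsto_Lp
      ((hV (ContinuousMap.toLp 2 volume ℂ g)).comp hns.tendsto_atTop)).exists_seq_tendsto_ae
    have h1 := ae_all_iff.2 fun n => coeFn_compMeasurePreserving_toLp (hS n) g
    filter_upwards [hms', hlim, h1, coeFn_compMeasurePreserving_toLp hR g] with x h2 h3 h4 h5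
    rw [h5]
    refine tendsto_nhds_unique h2 ?_
    simp only [Function.comp_apply, h4]
    exact ((g.continuous.tendsto _).comp h3).comp hms.tendsto_atTop
  intro f
  rw [← hfun]
  exact hV f

/-- Measure preserving maps inverse to each other almost everywhere come from an everywhere
defined invertible transformation. -/
theorem exists_invertibleMPT_of_ae_inverse {α : Type*} [MeasurableSpace α] {μ : Measure α}
    {S R : α → α} (hS : MeasurePreserving S μ μ) (hR : MeasurePreserving R μ μ)
    (hRS : ∀ᵐ x ∂μ, R (S x) = x) (hSR : ∀ᵐ x ∂μ, S (R x) = x) :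
    ∃ T : InvertibleMPT μ, T.toEquiv =ᵐ[μ] S := by
  classical
  obtain ⟨G, hG, hGm, hG0⟩ := exists_measurable_superset_of_null
    (ae_iff.1 (hRS.and hSR))
  have hG' : ∀ x ∉ G, R (S x) = x ∧ S (R x) = x := fun x hx => by
    by_contra h
    exact hx (hG h)
  -- X is a conull set of points whose forward S- and R-orbits avoid the bad null set. Both maps
  -- preserve it and are mutually inverse there, so S can be replaced by the identity off X.
  let X : Set α := ⋂ n : ℕ, (S^[n] ⁻¹' Gᶜ) ∩ (R^[n] ⁻¹' Gᶜ)
  have hX : MeasurableSet X := MeasurableSet.iInter fun n =>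
    ((hS.iterate n).measurable hGm.compl).inter ((hR.iterate n).measurable hGm.compl)
  have hXae : ∀ᵐ x ∂μ, x ∈ X := by
    have h1 : ∀ᵐ x ∂μ, x ∉ G := measure_eq_zero_iff_ae_notMem.1 hG0
    have h2 : ∀ᵐ x ∂μ, ∀ n : ℕ, S^[n] x ∉ G ∧ R^[n] x ∉ G := ae_all_iff.2 fun n =>
      ((hS.iterate n).quasiMeasurePreserving.ae h1).and
        ((hR.iterate n).quasiMeasurePreserving.ae h1)
    filter_upwards [h2] with x hx
    exact Set.mem_iInter.2 hx
  have hmem : ∀ x, x ∈ X ↔ ∀ n : ℕ, S^[n] x ∉ G ∧ R^[n] x ∉ G := fun x => Set.mem_iInter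
  have hXG : ∀ x ∈ X, R (S x) = x ∧ S (R x) = x := fun x hx => hG' x ((hmem x).1 hx 0).1
  have hSX : ∀ x ∈ X, S x ∈ X := by
    intro x hx
    rw [hmem]
    intro n
    refine ⟨by simpa only [Function.iterate_succ_apply] using ((hmem x).1 hx (n + 1)).1, ?_⟩
    cases n with
    | zero => exact ((hmem x).1 hx 1).1
    | succ n =>
      rw [Function.iterate_succ_apply, (hXG x hx).1]
      exact ((hmem x).1 hx n).2
  have hRX : ∀ x ∈ X, R x ∈ X := by
    intro x hx
    rw [hmem]
    intro n
    refine ⟨?_, by simpa only [Function.iterate_succ_apply] using ((hmem x).1 hx (n + 1)).2⟩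
    cases n with
    | zero => exact ((hmem x).1 hx 1).2
    | succ n =>
      rw [Function.iterate_succ_apply, (hXG x hx).2]
      exact ((hmem x).1 hx n).1
  let e : α ≃ᵐ α :=
    { toFun := X.piecewise S id
      invFun := X.piecewise R id
      left_inv := fun x => by
        by_cases hx : x ∈ X
        · simp [hx, hSX x hx, (hXG x hx).1]
        · simp [hx]
      right_inv := fun x => by
        by_cases hx : x ∈ X
        · simp [hx, hRX x hx, (hXG x hx).2]
        · simp [hx]
      measurable_toFun := hS.measurable.piecewise hX measurable_id
      measurable_invFun := hR.measurable.piecewise hX measurable_id }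
  have he : e =ᵐ[μ] S := by
    filter_upwards [hXae] with x hx
    exact Set.piecewise_eq_of_mem _ _ _ hx
  exact ⟨⟨e, e.measurable, by rw [Measure.map_congr he, hS.map_eq]⟩, he⟩

/-! ### Complete metrizability of the group. -/

namespace MeasureAut

/-- The images of the dyadic indicators under the Koopman operator and its inverse. -/
noncomputable def dyadicImages (T : MeasureAut (volume : Measure unitInterval)) :
    ℕ × ℕ → Lp ℂ 2 (volume : Measure unitInterval) × Lp ℂ 2 (volume : Measure unitInterval) :=
  fun p => (T.unitary (cellIndicator (2 ^ p.1) p.2), T.unitary.symm (cellIndicator (2 ^ p.1) p.2))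

theorem isInducing_dyadicImages : IsInducing dyadicImages := by
  rw [isInducing_iff_nhds]
  intro T
  refine le_antisymm ?_ ?_
  · refine (Continuous.tendsto ?_ T).le_comap
    exact continuous_pi fun p =>
      (continuous_unitary_apply _).prodMk (continuous_unitary_symm_apply _)
  · change Tendsto id (comap dyadicImages (𝓝 (dyadicImages T))) (𝓝 T)
    refine tendsto_of_tendsto_inner span_dyadicIndicators_dense ?_
    rintro e - _ ⟨p, rfl⟩
    have h1 : Tendsto (fun S => (dyadicImages S p).1) (comap dyadicImages (𝓝 (dyadicImages T)))
        (𝓝 (dyadicImages T p).1) :=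
      (continuous_fst.tendsto _).comp ((tendsto_pi_nhds.1 tendsto_comap) p)
    exact tendsto_const_nhds.inner h1

theorem injective_dyadicImages : Function.Injective dyadicImages := by
  intro T S h
  have h1 : T.unitary.toLinearIsometry.toContinuousLinearMap =
      S.unitary.toLinearIsometry.toContinuousLinearMap := by
    refine ContinuousLinearMap.ext_on (s := dyadicIndicators) ?_ ?_
    · exact Submodule.dense_iff_topologicalClosure_eq_top.2 span_dyadicIndicators_dense
    · rintro _ ⟨p, rfl⟩
      exact congrArg (fun F => (F p).1) h
  have h2 : T.unitary coordLp = S.unitary coordLp := DFunLike.congr_fun h1 coordLp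
  rw [← mk_rep T, ← mk_rep S]
  exact Quotient.sound (s := InvertibleMPT.aeSetoid volume) (ae_eq_of_comp_coordLp_eq _ _ h2)

/-- Images under the inverses are recorded because a strong limit of unitaries need not be
surjective. Here both limits exist and come from maps S and R whose composition operators are
mutually inverse, so S is invertible almost everywhere. -/
theorem isClosed_range_dyadicImages : IsClosed (Set.range dyadicImages) := by
  refine IsSeqClosed.isClosed ?_
  intro y z hy hz
  choose T hT using hy
  have hlim : ∀ p, Tendsto (fun n => dyadicImages (T n) p) atTop (𝓝 (z p)) := by
    simp only [hT]
    exact tendsto_pi_nhds.1 hz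
  have hU : ∀ f, ∃ g, Tendsto (fun n => (T n).unitary f) atTop (𝓝 g) :=
    exists_tendsto_of_span_dense (V := fun n => (T n).unitary.toLinearIsometry)
      span_dyadicIndicators_dense (by
        rintro _ ⟨p, rfl⟩
        exact ⟨(z p).1, (continuous_fst.tendsto _).comp (hlim p)⟩)
  have hW : ∀ f, ∃ g, Tendsto (fun n => (T n).unitary.symm f) atTop (𝓝 g) :=
    exists_tendsto_of_span_dense (V := fun n => (T n).unitary.symm.toLinearIsometry)
      span_dyadicIndicators_dense (by
        rintro _ ⟨p, rfl⟩
        exact ⟨(z p).2, (continuous_snd.tendsto _).comp (hlim p)⟩)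
  obtain ⟨S, hS, hUS⟩ := exists_measurePreserving_of_tendsto
    (fun n => (T n).rep.measurePreserving) hU
  obtain ⟨R, hR, hWR⟩ := exists_measurePreserving_of_tendsto
    (fun n => (T n).measurePreserving_rep_symm) hW
  have hSR : ∀ f : Lp ℂ 2 (volume : Measure unitInterval),
      Lp.compMeasurePreserving S hS (Lp.compMeasurePreserving R hR f) = f := by
    intro f
    refine tendsto_nhds_unique (tendsto_unitary_apply hUS (hWR f)) ?_
    refine tendsto_const_nhds.congr fun n => ?_
    rw [← unitary_symm_apply, LinearIsometryEquiv.apply_symm_apply]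
  have hRS : ∀ f : Lp ℂ 2 (volume : Measure unitInterval),
      Lp.compMeasurePreserving R hR (Lp.compMeasurePreserving S hS f) = f := by
    intro f
    refine tendsto_nhds_unique (hWR _) ?_
    rw [tendsto_iff_dist_tendsto_zero]
    have h1 := tendsto_iff_dist_tendsto_zero.1 (hUS f)
    refine h1.congr fun n => ?_
    rw [← unitary_symm_apply, ← (T n).unitary.dist_map ((T n).unitary.symm _),
      LinearIsometryEquiv.apply_symm_apply, dist_comm, ← unitary_apply]
  obtain ⟨T₀, hT₀⟩ := exists_invertibleMPT_of_ae_inverse hS hR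
    (ae_eq_of_comp_coordLp_eq (hR.comp hS) (MeasurePreserving.id _) (by
      refine (Lp.compMeasurePreserving_comp_apply coordLp hR hS).trans ?_
      rw [hSR]
      exact (Lp.compMeasurePreserving_id_apply coordLp).symm))
    (ae_eq_of_comp_coordLp_eq (hS.comp hR) (MeasurePreserving.id _) (by
      refine (Lp.compMeasurePreserving_comp_apply coordLp hS hR).trans ?_
      rw [hRS]
      exact (Lp.compMeasurePreserving_id_apply coordLp).symm))
  have hunit : ∀ f, (mk T₀).unitary f = Lp.compMeasurePreserving S hS f := by
    intro f
    rw [← koopman_eq, koopman_mk]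
    apply Lp.ext
    filter_upwards [Lp.coeFn_compMeasurePreserving f T₀.measurePreserving,
      Lp.coeFn_compMeasurePreserving f hS, hT₀] with x h1 h2 h3
    rw [h1, h2, Function.comp_apply, Function.comp_apply, h3]
  have hunit' : ∀ f, (mk T₀).unitary.symm f = Lp.compMeasurePreserving R hR f := by
    intro f
    rw [LinearIsometryEquiv.symm_apply_eq, hunit, hSR]
  refine ⟨mk T₀, funext fun p => Prod.ext ?_ ?_⟩
  · refine tendsto_nhds_unique ?_ ((continuous_fst.tendsto _).comp (hlim p))
    change Tendsto _ _ (𝓝 ((mk T₀).unitary _))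
    rw [hunit]
    exact hUS _
  · refine tendsto_nhds_unique ?_ ((continuous_snd.tendsto _).comp (hlim p))
    change Tendsto _ _ (𝓝 ((mk T₀).unitary.symm _))
    rw [hunit']
    exact hWR _

theorem baireSpace_unitInterval : BaireSpace (MeasureAut (volume : Measure unitInterval)) := by
  -- The target is a countable product of complete metric spaces, so a closed subspace is completely
  -- metrizable and therefore Baire.
  have h : IsClosedEmbedding dyadicImages :=
    ⟨⟨isInducing_dyadicImages, injective_dyadicImages⟩, isClosed_range_dyadicImages⟩
  have := h.IsCompletelyMetrizableSpace
  let := TopologicalSpace.upgradeIsCompletelyMetrizable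
    (MeasureAut (volume : Measure unitInterval))
  infer_instance

end MeasureAut

/-! ### Permutations of grid cells as measure preserving transformations. -/

namespace GridPermutation

variable {n : ℕ}

/-- The map permuting the cells of the grid of mesh `1 / n` by translations. -/
noncomputable def toReal (n : ℕ) (σ : Equiv.Perm ℕ) (x : ℝ) : ℝ :=
  (σ ⌊n * x⌋₊ + Int.fract (n * x)) / n

theorem mul_toReal (hn : 0 < n) (σ : Equiv.Perm ℕ) (x : ℝ) :
    n * toReal n σ x = σ ⌊n * x⌋₊ + Int.fract (n * x) := by
  have hn' : (n : ℝ) ≠ 0 := by exact_mod_cast hn.ne'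
  rw [toReal]
  field_simp

theorem floor_mul_toReal (hn : 0 < n) (σ : Equiv.Perm ℕ) (x : ℝ) :
    ⌊n * toReal n σ x⌋₊ = σ ⌊n * x⌋₊ := by
  rw [mul_toReal hn, Nat.floor_eq_iff (by positivity)]
  exact ⟨by linarith [Int.fract_nonneg ((n : ℝ) * x)], by linarith [Int.fract_lt_one ((n : ℝ) * x)]⟩

theorem toReal_eq_add (hn : 0 < n) (σ : Equiv.Perm ℕ) {x : ℝ} (hx : 0 ≤ x) :
    toReal n σ x = x + ((σ ⌊n * x⌋₊ : ℝ) - ⌊n * x⌋₊) / n := by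
  have hn' : (n : ℝ) ≠ 0 := by exact_mod_cast hn.ne'
  have h1 : (⌊n * x⌋₊ : ℝ) = ⌊n * x⌋ := natCast_floor_eq_intCast_floor (by positivity)
  have h2 := Int.self_sub_floor ((n : ℝ) * x)
  rw [toReal, ← h2, ← h1]
  field_simp
  ring

theorem toReal_toReal (hn : 0 < n) (σ τ : Equiv.Perm ℕ) (h : ∀ i, τ (σ i) = i) {x : ℝ}
    (hx : 0 ≤ x) : toReal n τ (toReal n σ x) = x := by
  have h0 : 0 ≤ toReal n σ x := by rw [toReal]; positivity
  rw [toReal_eq_add hn τ h0, floor_mul_toReal hn, h, toReal_eq_add hn σ hx]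
  ring

/-- Permutations of all of ℕ are used so that the endpoint 1, of index n, is covered too: it stays
fixed. -/
theorem toReal_mem (hn : 0 < n) {σ : Equiv.Perm ℕ} (hσ : ∀ i, n ≤ i → σ i = i) {x : ℝ}
    (hx : x ∈ unitInterval) : toReal n σ x ∈ unitInterval := by
  have hn' : (0 : ℝ) < n := by exact_mod_cast hn
  refine ⟨by rw [toReal]; positivity, ?_⟩
  by_cases h : ⌊n * x⌋₊ < n
  · have h1 : σ ⌊n * x⌋₊ < n := by
      by_contra h2
      have h3 := hσ _ (not_lt.1 h2)
      exact h2 (by rw [σ.injective h3]; exact h)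
    have h2 : (σ ⌊n * x⌋₊ : ℝ) + 1 ≤ n := by exact_mod_cast h1
    rw [toReal, div_le_one hn']
    linarith [Int.fract_lt_one ((n : ℝ) * x)]
  · rw [toReal_eq_add hn σ hx.1, hσ _ (not_lt.1 h)]
    simpa using hx.2

theorem measurable_toReal (n : ℕ) (σ : Equiv.Perm ℕ) : Measurable (toReal n σ) := by
  have h1 : Measurable fun x : ℝ => (n : ℝ) * x := measurable_id.const_mul _
  have h2 : Measurable fun x : ℝ => ((σ ⌊n * x⌋₊ : ℕ) : ℝ) :=
    (measurable_of_countable fun i : ℕ => ((σ i : ℕ) : ℝ)).comp h1.nat_floor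
  exact (h2.add (measurable_fract.comp h1)).div_const _

/-- The permutation of cells as a measurable equivalence of the unit interval. -/
noncomputable def equiv (hn : 0 < n) (σ : Equiv.Perm ℕ) (hσ : ∀ i, n ≤ i → σ i = i) :
    unitInterval ≃ᵐ unitInterval where
  toFun x := ⟨toReal n σ x, toReal_mem hn hσ x.2⟩
  invFun x := ⟨toReal n σ.symm x, toReal_mem hn
    (fun i hi => by rw [Equiv.symm_apply_eq, hσ i hi]) x.2⟩
  left_inv x := Subtype.ext (toReal_toReal hn σ σ.symm (by simp) x.2.1)
  right_inv x := Subtype.ext (toReal_toReal hn σ.symm σ (by simp) x.2.1)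
  measurable_toFun := ((measurable_toReal n σ).comp measurable_subtype_coe).subtype_mk
  measurable_invFun := ((measurable_toReal n σ.symm).comp measurable_subtype_coe).subtype_mk

theorem floor_equiv (hn : 0 < n) (σ : Equiv.Perm ℕ) (hσ : ∀ i, n ≤ i → σ i = i)
    (x : unitInterval) : ⌊(n : ℝ) * equiv hn σ hσ x⌋₊ = σ ⌊(n : ℝ) * x⌋₊ :=
  floor_mul_toReal hn σ x

theorem floor_iterate_equiv (hn : 0 < n) (σ : Equiv.Perm ℕ) (hσ : ∀ i, n ≤ i → σ i = i)
    (t : ℕ) (x : unitInterval) :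
    ⌊(n : ℝ) * ((equiv hn σ hσ)^[t] x : unitInterval)⌋₊ = (σ ^ t) ⌊(n : ℝ) * x⌋₊ := by
  induction t with
  | zero => simp
  | succ t ih => rw [Function.iterate_succ_apply', floor_equiv, ih, pow_succ', Equiv.Perm.mul_apply]

theorem volume_eq_tsum_gridCell (n : ℕ) {A : Set unitInterval} (hA : MeasurableSet A) :
    volume A = ∑' i, volume (A ∩ gridCell n i) := by
  have h0 : ⋃ i, gridCell n i = Set.univ :=
    Set.eq_univ_of_forall fun x => Set.mem_iUnion.2 ⟨⌊(n : ℝ) * x⌋₊, rfl⟩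
  have h : A = ⋃ i, A ∩ gridCell n i := by rw [← Set.inter_iUnion, h0, Set.inter_univ]
  conv_lhs => rw [h]
  refine measure_iUnion (fun i j hij => ?_) fun i => hA.inter (measurableSet_gridCell n i)
  exact (disjoint_gridCell n hij).mono Set.inter_subset_right Set.inter_subset_right

theorem measurePreserving_equiv (hn : 0 < n) (σ : Equiv.Perm ℕ) (hσ : ∀ i, n ≤ i → σ i = i) :
    MeasurePreserving (equiv hn σ hσ) volume volume := by
  refine ⟨(equiv hn σ hσ).measurable, Measure.ext fun A hA => ?_⟩
  have hA' := (equiv hn σ hσ).measurable hA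
  rw [Measure.map_apply (equiv hn σ hσ).measurable hA, volume_eq_tsum_gridCell n hA',
    volume_eq_tsum_gridCell n hA, ← Equiv.tsum_eq σ (fun i => volume (A ∩ gridCell n i))]
  congr 1
  funext i
  -- The part of the preimage in cell i is a translate of the part of A in cell σ i.
  have h1 : Subtype.val '' (equiv hn σ hσ ⁻¹' A ∩ gridCell n i) =
      (fun y => y + ((σ i : ℝ) - i) / n) ⁻¹' (Subtype.val '' (A ∩ gridCell n (σ i))) := by
    ext y
    simp only [Set.mem_image, Set.mem_preimage]
    constructor
    · rintro ⟨x, ⟨hxA, hx⟩, rfl⟩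
      refine ⟨equiv hn σ hσ x, ⟨hxA, ?_⟩, ?_⟩
      · change ⌊(n : ℝ) * equiv hn σ hσ x⌋₊ = σ i
        rw [floor_equiv, show ⌊(n : ℝ) * x⌋₊ = i from hx]
      · have h2 := toReal_eq_add hn σ x.2.1
        rw [show ⌊(n : ℝ) * x⌋₊ = i from hx] at h2
        exact h2
    · rintro ⟨z, ⟨hzA, hz⟩, hzy⟩
      have h3 : ⌊(n : ℝ) * (equiv hn σ hσ).symm z⌋₊ = i := by
        apply σ.injective
        rw [← floor_equiv hn σ hσ, MeasurableEquiv.apply_symm_apply]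
        exact hz
      refine ⟨(equiv hn σ hσ).symm z, ⟨by simpa using hzA, h3⟩, ?_⟩
      have h4 := toReal_eq_add hn σ ((equiv hn σ hσ).symm z).2.1
      rw [h3] at h4
      have h5 : toReal n σ ((equiv hn σ hσ).symm z) = z :=
        congrArg Subtype.val ((equiv hn σ hσ).apply_symm_apply z)
      linarith
  rw [unitInterval.volume_apply, unitInterval.volume_apply, h1, measure_preimage_add_right]

/-- The class of a permutation of cells. -/
noncomputable def toMeasureAut (hn : 0 < n) (σ : Equiv.Perm ℕ) (hσ : ∀ i, n ≤ i → σ i = i) :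
    MeasureAut (volume : Measure unitInterval) :=
  MeasureAut.mk ⟨equiv hn σ hσ, measurePreserving_equiv hn σ hσ⟩

theorem measureReal_floor_mem (s : Finset ℕ) (hs : ∀ a ∈ s, a < n) :
    (volume : Measure unitInterval).real {x | ⌊(n : ℝ) * x⌋₊ ∈ s} = s.card / n := by
  have h : {x : unitInterval | ⌊(n : ℝ) * x⌋₊ ∈ s} = ⋃ a ∈ s, gridCell n a := by
    ext x
    simp [gridCell]
  rw [h, measureReal_biUnion_finset (fun a _ b _ hab => disjoint_gridCell n hab)
    fun a _ => measurableSet_gridCell n a, Finset.sum_congr rfl fun a ha =>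
    measureReal_gridCell (hs a ha)]
  simp [div_eq_mul_inv]

theorem correlation_toMeasureAut {K L : ℕ} (hn : 0 < K * L) (σ : Equiv.Perm ℕ)
    (hσ : ∀ i, K * L ≤ i → σ i = i) (t : ℕ) {i : ℕ} (hi : i < K) (j : ℕ) :
    (toMeasureAut hn σ hσ).correlation t (gridCell K i) (gridCell K j) =
      ((Finset.range (K * L)).filter fun a => a / L = i ∧ (σ ^ t) a / L = j).card
        / ((K * L : ℕ) : ℝ) := by
  have hL : 0 < L := Nat.pos_of_mul_pos_left hn
  rw [toMeasureAut, MeasureAut.correlation_mk, ← measureReal_floor_mem _ (fun a ha =>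
    Finset.mem_range.1 (Finset.mem_filter.1 ha).1)]
  congr 1
  ext x
  have h1 : ⌊((K * L : ℕ) : ℝ) * x⌋₊ / L = i → ⌊((K * L : ℕ) : ℝ) * x⌋₊ < K * L := by
    intro h
    exact (Nat.div_lt_iff_lt_mul hL).1 (h ▸ hi)
  have h2 := mem_gridCell_iff_floor_div (K := K) i hL x
  have h3 := mem_gridCell_iff_floor_div (K := K) j hL ((equiv hn σ hσ)^[t] x)
  rw [floor_iterate_equiv] at h3
  simp only [gridCell, Set.mem_inter_iff, Set.mem_preimage, Set.mem_ofPred_eq, h2, h3,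
    Finset.mem_filter, Finset.mem_range]
  tauto

/-- A finite permutation with equidistributed labels is realized by a transformation of the unit
interval for which the labels are the cells of a grid. -/
theorem exists_correlation_eq {K : ℕ} {F : Type*} [Fintype F] [Nonempty F] (σ : Equiv.Perm F)
    (ℓ : F → Fin K)
    (hℓ : ∀ i, (Finset.univ.filter fun a => ℓ a = i).card * K = Fintype.card F) :
    ∃ T : MeasureAut (volume : Measure unitInterval), ∀ (t : ℕ) (i j : Fin K),
      T.correlation t (gridCell K i) (gridCell K j) =
        (Finset.univ.filter fun a => ℓ a = i ∧ ℓ ((σ ^ t) a) = j).card / (Fintype.card F : ℝ) := by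
  have hF : 0 < Fintype.card F := Fintype.card_pos
  have hK : 0 < K := by
    obtain ⟨a⟩ := ‹Nonempty F›
    exact (Nat.zero_le _).trans_lt (ℓ a).2
  obtain ⟨L, hL⟩ : ∃ L, Fintype.card F = K * L :=
    ⟨_, by rw [← hℓ ⟨0, hK⟩, mul_comm]⟩
  have hn : 0 < K * L := hL ▸ hF
  have hL0 : 0 < L := Nat.pos_of_mul_pos_left hn
  have hfib : ∀ i, Nonempty ({a // ℓ a = i} ≃ Fin L) := fun i => by
    rw [← Fintype.card_eq, Fintype.card_fin, Fintype.card_subtype]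
    have h := hℓ i
    rw [hL, mul_comm] at h
    exact Nat.eq_of_mul_eq_mul_left hK h
  -- Number F so that the points labelled i fill the i-th block of L consecutive integers; the label
  -- is then the quotient by L.
  let e : F ≃ Fin (K * L) := (Equiv.sigmaFiberEquiv ℓ).symm.trans
    ((Equiv.sigmaCongrRight fun i => (hfib i).some).trans
      ((Equiv.sigmaEquivProd _ _).trans finProdFinEquiv))
  have he : ∀ a, (e a : ℕ) / L = ℓ a := by
    intro a
    have h1 : (e a : ℕ) = (hfib (ℓ a)).some ⟨a, rfl⟩ + L * ℓ a := rfl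
    rw [h1, Nat.add_mul_div_left _ _ hL0, Nat.div_eq_of_lt (Fin.is_lt _), zero_add]
  let τ : Equiv.Perm ℕ := (e.permCongr σ).extendDomain Fin.equivSubtype
  have hτ : ∀ i, K * L ≤ i → τ i = i := fun i hi =>
    Equiv.Perm.extendDomain_apply_not_subtype _ _ (not_lt.2 hi)
  have hτe : ∀ (t : ℕ) (a : F), (τ ^ t) (e a) = e ((σ ^ t) a) := by
    intro t
    induction t with
    | zero => intro a; rfl
    | succ t ih =>
      intro a
      rw [pow_succ', Equiv.Perm.mul_apply, ih, pow_succ', Equiv.Perm.mul_apply]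
      have h1 := Equiv.Perm.extendDomain_apply_image (e.permCongr σ) Fin.equivSubtype
        (e ((σ ^ t) a))
      refine h1.trans ?_
      simp [Fin.equivSubtype]
  refine ⟨toMeasureAut hn τ hτ, fun t i j => ?_⟩
  rw [correlation_toMeasureAut hn τ hτ t i.2 j, hL]
  congr 2
  symm
  refine Finset.card_bij (fun a _ => (e a : ℕ)) ?_ ?_ ?_
  · intro a ha
    simp only [Finset.mem_filter, Finset.mem_univ, true_and, Finset.mem_range] at ha ⊢
    rw [hτe, he, he, ha.1, ha.2]
    exact ⟨(e a).2, rfl, rfl⟩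
  · intro a _ b _ hab
    exact e.injective (Fin.ext hab)
  · intro b hb
    simp only [Finset.mem_filter, Finset.mem_range] at hb
    obtain ⟨hb, h1, h2⟩ := hb
    obtain ⟨a, ha⟩ := e.surjective ⟨b, hb⟩
    have hab : (e a : ℕ) = b := by rw [ha]
    rw [← hab, he] at h1
    rw [← hab, hτe, he] at h2
    exact ⟨a, by simp [Fin.ext h1, Fin.ext h2], hab⟩

end GridPermutation

/-! ### Periodic words with prescribed transition frequencies. -/

namespace PeriodicWord

theorem sum_range_mul (B L : ℕ) (φ : ℕ → ℝ) :
    ∑ n ∈ Finset.range (B * L), φ n =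
      ∑ b ∈ Finset.range B, ∑ t ∈ Finset.range L, φ (t + L * b) := by
  induction B with
  | zero => simp
  | succ B ih =>
    rw [Nat.succ_mul, Finset.sum_range_add, Finset.sum_range_succ, ih]
    congr 1
    exact Finset.sum_congr rfl fun t _ => by rw [add_comm, mul_comm]

theorem sum_range_mul_of_periodic {q : ℕ} {φ : ℕ → ℝ} (hφ : Function.Periodic φ q) (A : ℕ) :
    ∑ n ∈ Finset.range (A * q), φ n = A * ∑ n ∈ Finset.range q, φ n := by
  rw [sum_range_mul]
  have h : ∀ b t, φ (t + q * b) = φ t := fun b t => by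
    rw [mul_comm]
    exact hφ.nat_mul b t
  simp [h]

/-- Probability weights on a finite type are approximated by the frequencies of a finite word. -/
theorem exists_frequency_approx {S : Type*} [Fintype S] [DecidableEq S] [Nonempty S] {w : S → ℝ}
    (hw : ∀ x, 0 ≤ w x) (hw1 : ∑ x, w x = 1) {ε : ℝ} (hε : 0 < ε) :
    ∃ (V : ℕ) (s : ℕ → S), 0 < V ∧
      ∀ x, |(∑ v ∈ Finset.range V, if s v = x then (1 : ℝ) else 0) / V - w x| ≤ ε := by
  obtain ⟨D, hD⟩ := exists_nat_gt (Fintype.card S / ε)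
  have hD0 : (0 : ℝ) < D := lt_of_le_of_lt (by positivity) hD
  -- Rounding up moves each count by at most 1 and the total by at most the size of S, which is
  -- negligible against D.
  let a : S → ℕ := fun x => ⌈w x * D⌉₊
  let V := ∑ x, a x
  have ha1 : ∀ x, w x * D ≤ a x := fun x => Nat.le_ceil _
  have ha2 : ∀ x, (a x : ℝ) ≤ w x * D + 1 := fun x =>
    (Nat.ceil_lt_add_one (mul_nonneg (hw x) hD0.le)).le
  have hV1 : (D : ℝ) ≤ V := by
    have h : ∑ x, w x * D ≤ ∑ x, (a x : ℝ) := Finset.sum_le_sum fun x _ => ha1 x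
    rw [← Finset.sum_mul, hw1, one_mul] at h
    simpa [V] using h
  have hV2 : (V : ℝ) ≤ D + Fintype.card S := by
    have h : ∑ x, (a x : ℝ) ≤ ∑ x, (w x * D + 1) := Finset.sum_le_sum fun x _ => ha2 x
    rw [Finset.sum_add_distrib, ← Finset.sum_mul, hw1, one_mul] at h
    simpa [V] using h
  have hV0 : (0 : ℝ) < V := hD0.trans_le hV1
  have hVpos : 0 < V := by exact_mod_cast hV0
  have hcard : Fintype.card (Σ x, Fin (a x)) = V := by simp [V]
  let e : Fin V ≃ Σ x, Fin (a x) := (Fintype.equivFinOfCardEq hcard).symm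
  refine ⟨V, fun v => if h : v < V then (e ⟨v, h⟩).1 else Classical.arbitrary S, hVpos,
    fun x => ?_⟩
  have hcount : (∑ v ∈ Finset.range V, if (if h : v < V then (e ⟨v, h⟩).1 else
      Classical.arbitrary S) = x then (1 : ℝ) else 0) = a x := by
    rw [Finset.sum_range]
    simp only [Fin.is_lt, dif_pos, Fin.eta]
    rw [Equiv.sum_comp e fun y => if y.1 = x then (1 : ℝ) else 0, Fintype.sum_sigma,
      Finset.sum_eq_single x (fun y _ hy => by simp [hy]) (by simp)]
    simp
  have hwx : w x ≤ 1 := hw1 ▸ Finset.single_le_sum (fun y _ => hw y) (Finset.mem_univ x)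
  have hS : (1 : ℝ) ≤ Fintype.card S := by exact_mod_cast Fintype.card_pos
  have hSD : (Fintype.card S : ℝ) ≤ ε * V := by
    rw [div_lt_iff₀' hε] at hD
    exact hD.le.trans (mul_le_mul_of_nonneg_left hV1 hε.le)
  rw [hcount]
  have h1 : (a x : ℝ) / V - w x = (a x - w x * V) / V := by field_simp
  rw [h1, abs_div, abs_of_pos hV0, div_le_iff₀ hV0, abs_le]
  have h2 : w x * D ≤ w x * V := mul_le_mul_of_nonneg_left hV1 (hw x)
  have h3 : w x * V ≤ w x * (D + Fintype.card S) := mul_le_mul_of_nonneg_left hV2 (hw x)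
  have h4 : w x * Fintype.card S ≤ 1 * Fintype.card S :=
    mul_le_mul_of_nonneg_right hwx (by positivity)
  constructor
  · nlinarith [ha1 x]
  · nlinarith [ha2 x]

/-- The word running along the orbits, of length `L`, of all points under the permutations
`s 0, …, s (V - 1)`, repeated periodically. -/
def orbitWord {K : ℕ} (hK : 0 < K) (s : ℕ → Equiv.Perm (Fin K)) (V L n : ℕ) : Fin K :=
  (s (n % (V * K * L) / L / K) ^ (n % (V * K * L) % L)) ⟨n % (V * K * L) / L % K, Nat.mod_lt _ hK⟩

section OrbitWord

variable {K : ℕ} (hK : 0 < K) (s : ℕ → Equiv.Perm (Fin K)) {V L : ℕ}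

theorem periodic_orbitWord (V L : ℕ) : Function.Periodic (orbitWord hK s V L) (V * K * L) := by
  intro n
  simp only [orbitWord, Nat.add_mod_right]

theorem orbitWord_apply {v t : ℕ} (hv : v < V) (i : Fin K) (ht : t < L) :
    orbitWord hK s V L (t + L * (i + K * v)) = (s v ^ t) i := by
  have hL : 0 < L := by omega
  have h1 : (i : ℕ) + K * v < V * K := by
    have : K * (v + 1) ≤ K * V := Nat.mul_le_mul_left K hv
    have hi := i.2
    rw [mul_comm V K]
    linarith
  have h2 : t + L * (i + K * v) < V * K * L := by
    have : L * (i + K * v + 1) ≤ L * (V * K) := Nat.mul_le_mul_left L h1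
    rw [mul_comm (V * K) L]
    linarith
  have h3 : (t + L * (i + K * v)) / L = i + K * v := by
    rw [Nat.add_mul_div_left _ _ hL, Nat.div_eq_of_lt ht, zero_add]
  have h4 : ((i : ℕ) + K * v) / K = v := by
    rw [Nat.add_mul_div_left _ _ hK, Nat.div_eq_of_lt i.2, zero_add]
  have h5 : ((i : ℕ) + K * v) % K = i := by rw [Nat.add_mul_mod_self_left, Nat.mod_eq_of_lt i.2]
  have h6 : (t + L * (i + K * v)) % L = t := by rw [Nat.add_mul_mod_self_left, Nat.mod_eq_of_lt ht]
  simp only [orbitWord, Nat.mod_eq_of_lt h2, h3, h4, h5, h6, Fin.eta]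

theorem sum_range_orbit (K V L : ℕ) (φ : ℕ → ℝ) :
    ∑ n ∈ Finset.range (V * K * L), φ n =
      ∑ v ∈ Finset.range V, ∑ i : Fin K, ∑ t ∈ Finset.range L, φ (t + L * (i + K * v)) := by
  rw [sum_range_mul, sum_range_mul]
  refine Finset.sum_congr rfl fun v _ => ?_
  rw [Finset.sum_range]

theorem sum_orbitWord_eq (g : ℕ → Fin K → ℝ) :
    (∑ v ∈ Finset.range V, ∑ i : Fin K, ∑ t ∈ Finset.range L,
      g v (orbitWord hK s V L (t + L * (i + K * v)))) =
      L * ∑ v ∈ Finset.range V, ∑ i, g v i := by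
  rw [Finset.mul_sum]
  refine Finset.sum_congr rfl fun v hv => ?_
  rw [Finset.sum_comm]
  have h : ∀ t ∈ Finset.range L, (∑ i : Fin K, g v (orbitWord hK s V L (t + L * (i + K * v)))) =
      ∑ i, g v i := by
    intro t ht
    simp only [orbitWord_apply hK s (Finset.mem_range.1 hv) _ (Finset.mem_range.1 ht)]
    exact Equiv.sum_comp (s v ^ t) (g v)
  rw [Finset.sum_congr rfl h]
  simp

/-- For fixed v and t, the letters obtained from all starting points are a permutation of the
alphabet, so the count is exact. -/
theorem sum_orbitWord_label (V L : ℕ) (i : Fin K) :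
    (∑ n ∈ Finset.range (V * K * L), if orbitWord hK s V L n = i then (1 : ℝ) else 0) = V * L := by
  rw [sum_range_orbit, sum_orbitWord_eq hK s fun _ x => if x = i then (1 : ℝ) else 0]
  simp [mul_comm]

/-- Inside an orbit segment the next letter is the image under `s v`; only the V * K junctions
between segments can be wrong. -/
theorem abs_sum_orbitWord_pair_sub_le (i j : Fin K) :
    |(∑ n ∈ Finset.range (V * K * L),
      if orbitWord hK s V L n = i ∧ orbitWord hK s V L (n + 1) = j then (1 : ℝ) else 0) -
        L * ∑ v ∈ Finset.range V, if s v i = j then (1 : ℝ) else 0| ≤ V * K := by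
  have h1 : (L : ℝ) * ∑ v ∈ Finset.range V, (if s v i = j then (1 : ℝ) else 0) =
      L * ∑ v ∈ Finset.range V, ∑ x, if x = i ∧ s v x = j then (1 : ℝ) else 0 := by
    congr 1
    refine Finset.sum_congr rfl fun v _ => ?_
    rw [Finset.sum_eq_single i]
    · simp
    · intro x _ hx
      simp [hx]
    · simp
  rw [h1, sum_range_orbit, ← sum_orbitWord_eq hK s fun v x =>
    if x = i ∧ s v x = j then (1 : ℝ) else 0, ← Finset.sum_sub_distrib]
  have h2 : (V * K : ℝ) = ∑ v ∈ Finset.range V, ∑ i : Fin K, 1 := by simp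
  rw [h2]
  refine (Finset.abs_sum_le_sum_abs _ _).trans (Finset.sum_le_sum fun v hv => ?_)
  rw [← Finset.sum_sub_distrib]
  refine (Finset.abs_sum_le_sum_abs _ _).trans (Finset.sum_le_sum fun x _ => ?_)
  rw [← Finset.sum_sub_distrib]
  rcases Nat.eq_zero_or_pos L with rfl | hL
  · simp
  obtain ⟨L, rfl⟩ : ∃ L', L = L' + 1 := ⟨L - 1, by omega⟩
  rw [Finset.sum_range_succ, Finset.sum_eq_zero, zero_add]
  · split_ifs <;> norm_num
  · intro t ht
    have ht := Finset.mem_range.1 ht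
    have hv := Finset.mem_range.1 hv
    have e1 : t + (L + 1) * (x + K * v) + 1 = (t + 1) + (L + 1) * (x + K * v) := by ring
    rw [e1, orbitWord_apply hK s hv x (by omega), orbitWord_apply hK s hv x (by omega), pow_succ',
      Equiv.Perm.mul_apply, sub_self]

end OrbitWord

/-- A doubly stochastic matrix is approximated by the transition frequencies of a periodic word in
which all letters have the same frequency. -/
theorem exists_word {K : ℕ} (hK : 0 < K) {M : Matrix (Fin K) (Fin K) ℝ}
    (hM : M ∈ doublyStochastic ℝ (Fin K)) {ε : ℝ} (hε : 0 < ε) :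
    ∃ (q : ℕ) (w : ℕ → Fin K), 0 < q ∧ Function.Periodic w q ∧
      (∀ i, (∑ n ∈ Finset.range q, if w n = i then (1 : ℝ) else 0) = q / K) ∧
      ∀ i j, |(∑ n ∈ Finset.range q, if w n = i ∧ w (n + 1) = j then (1 : ℝ) else 0) / q -
        M i j / K| ≤ ε := by
  classical
  -- Birkhoff's theorem. The weights become frequencies of the permutations among `s 0, …, s (V -
  -- 1)`.
  obtain ⟨c, hc, hc1, hcM⟩ := exists_eq_sum_perm_of_mem_doublyStochastic hM
  let k := Fintype.card (Equiv.Perm (Fin K))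
  have hk : (0 : ℝ) < k := by exact_mod_cast Fintype.card_pos
  have hK' : (0 : ℝ) < K := by exact_mod_cast hK
  obtain ⟨V, s, hV, hs⟩ := exists_frequency_approx hc hc1 (ε := ε / 2 / k) (by positivity)
  have hV' : (0 : ℝ) < V := by exact_mod_cast hV
  -- With segments this long, the V * K junctions are at most a proportion ε/2 of the V * K * L
  -- positions.
  obtain ⟨L, hL⟩ := exists_nat_gt (2 / ε)
  have hL' : (0 : ℝ) < L := lt_trans (by positivity) hL
  have hL0 : 0 < L := by exact_mod_cast hL'
  refine ⟨V * K * L, orbitWord hK s V L, by positivity, periodic_orbitWord hK s V L,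
    fun i => ?_, fun i j => ?_⟩
  · rw [sum_orbitWord_label]
    push_cast
    field_simp
  · have hMij : M i j = ∑ σ : Equiv.Perm (Fin K), c σ * if σ i = j then 1 else 0 := by
      rw [← hcM, Matrix.sum_apply]
      refine Finset.sum_congr rfl fun σ _ => ?_
      simp [Equiv.Perm.permMatrix, PEquiv.toMatrix_apply, eq_comm]
    have hfreq : (∑ v ∈ Finset.range V, if s v i = j then (1 : ℝ) else 0) =
        ∑ σ : Equiv.Perm (Fin K), (∑ v ∈ Finset.range V, if s v = σ then (1 : ℝ) else 0) *
          if σ i = j then 1 else 0 := by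
      simp only [Finset.sum_mul]
      rw [Finset.sum_comm]
      refine Finset.sum_congr rfl fun v _ => ?_
      simp only [ite_mul, one_mul, zero_mul]
      rw [Finset.sum_ite_eq, if_pos (Finset.mem_univ _)]
    have h1 : |(∑ v ∈ Finset.range V, if s v i = j then (1 : ℝ) else 0) / V - M i j| ≤ ε / 2 := by
      rw [hfreq, hMij, Finset.sum_div, ← Finset.sum_sub_distrib]
      refine (Finset.abs_sum_le_sum_abs _ _).trans ?_
      have h2 : ε / 2 = ∑ σ : Equiv.Perm (Fin K), ε / 2 / k := by
        rw [Finset.sum_const, Finset.card_univ, nsmul_eq_mul]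
        field_simp
        simp [k]
      rw [h2]
      refine Finset.sum_le_sum fun σ _ => ?_
      rw [mul_div_right_comm, ← sub_mul, abs_mul]
      refine (mul_le_of_le_one_right (abs_nonneg _) ?_).trans (hs σ)
      split_ifs <;> simp
    have h2 := abs_sum_orbitWord_pair_sub_le hK s (V := V) (L := L) i j
    set X := ∑ n ∈ Finset.range (V * K * L),
      if orbitWord hK s V L n = i ∧ orbitWord hK s V L (n + 1) = j then (1 : ℝ) else 0
    set Y := ∑ v ∈ Finset.range V, if s v i = j then (1 : ℝ) else 0
    have h3 : X / (V * K * L : ℕ) - M i j / K = (X - L * Y) / (V * K * L) + (Y / V - M i j) / K := by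
      push_cast
      field_simp
      ring
    have h4 : |(X - L * Y) / (V * K * L)| ≤ ε / 2 := by
      rw [abs_div, abs_of_pos (by positivity : (0 : ℝ) < V * K * L), div_le_iff₀ (by positivity)]
      rw [div_lt_iff₀ hε] at hL
      have h6 : V * K * 1 ≤ V * K * (ε / 2 * L) :=
        mul_le_mul_of_nonneg_left (by linarith) (by positivity)
      linarith
    have h5 : |(Y / V - M i j) / K| ≤ ε / 2 := by
      rw [abs_div, abs_of_pos hK']
      have hK1 : (1 : ℝ) ≤ K := by exact_mod_cast hK
      exact (div_le_self (abs_nonneg _) hK1).trans h1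
    rw [h3]
    exact (abs_add_le _ _).trans (by linarith)

end PeriodicWord

/-! ### Columns closed up into cycles of length m + c. -/

namespace PeriodicWord

section CycleRange

variable {H h : ℕ}

theorem cycleRange_pow_of_lt (hh : 0 < h) (hH : h ≤ H) {t : ℕ} {n : Fin H} (hn : n + t < h) :
    (((Fin.cycleRange (⟨h - 1, by omega⟩ : Fin H)) ^ t) n : ℕ) = n + t := by
  induction t with
  | zero => simp
  | succ t ih =>
    have ih := ih (by omega)
    rw [pow_succ', Equiv.Perm.mul_apply, Fin.coe_cycleRange_of_lt, ih]
    · ring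
    · rw [Fin.lt_def, ih]
      simp only
      omega

theorem cycleRange_pow_period (hh : 0 < h) (hH : h ≤ H) {n : Fin H} (hn : n < h) :
    ((Fin.cycleRange (⟨h - 1, by omega⟩ : Fin H)) ^ h) n = n := by
  have : NeZero H := ⟨by omega⟩
  set σ := Fin.cycleRange (⟨h - 1, by omega⟩ : Fin H)
  have h1 : (σ ^ (h - 1 - n)) n = ⟨h - 1, by omega⟩ := by
    apply Fin.ext
    rw [cycleRange_pow_of_lt hh hH (by omega)]
    simp only
    omega
  have h2 : σ ⟨h - 1, by omega⟩ = 0 := Fin.cycleRange_self _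
  have h3 : (σ ^ (n : ℕ)) 0 = n := by
    apply Fin.ext
    rw [cycleRange_pow_of_lt hh hH (by simpa using hn)]
    simp
  -- Climb from n to the top, wrap to 0, and climb back to n.
  have h4 : σ ^ h = σ ^ (n : ℕ) * σ * σ ^ (h - 1 - n) := by
    rw [← pow_succ, ← pow_add]
    congr 1
    omega
  rw [h4, Equiv.Perm.mul_apply, Equiv.Perm.mul_apply, h1, h2, h3]

/-- In a cycle of length h, advancing by h - c is the same as going back by c. With h = m + c this
computes the m-th power. -/
theorem cycleRange_pow_sub {c : ℕ} (hh : 0 < h) (hH : h ≤ H) {n : Fin H} (hc : c ≤ n)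
    (hn : n < h) : (((Fin.cycleRange (⟨h - 1, by omega⟩ : Fin H)) ^ (h - c)) n : ℕ) = n - c := by
  set σ := Fin.cycleRange (⟨h - 1, by omega⟩ : Fin H)
  have h1 : (σ ^ c) ⟨n - c, by omega⟩ = n := by
    apply Fin.ext
    rw [cycleRange_pow_of_lt hh hH (by simp only; omega)]
    simp only
    omega
  have h2 : (σ ^ (h - c)) n = ⟨n - c, by omega⟩ := by
    conv_lhs => rw [← h1]
    rw [← Equiv.Perm.mul_apply, ← pow_add, Nat.sub_add_cancel (by omega),
      cycleRange_pow_period hh hH (by simp only; omega)]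
  rw [h2]

end CycleRange

/-- Sums of functions with values in `[0,1]` agreeing on `[c, h)`. -/
theorem abs_sum_sub_sum_le {H c h B : ℕ} (f : Fin H → ℝ) (g : ℕ → ℝ)
    (hf : ∀ n, f n ∈ Set.Icc (0 : ℝ) 1) (hg : ∀ n, g n ∈ Set.Icc (0 : ℝ) 1)
    (hfg : ∀ n : Fin H, c ≤ n → n < h → f n = g n) (hB : c + (H - h) ≤ B) :
    |∑ n, f n - ∑ n ∈ Finset.range H, g n| ≤ B := by
  rw [Finset.sum_range, ← Finset.sum_sub_distrib]
  refine (Finset.abs_sum_le_sum_abs _ _).trans ?_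
  have h1 : ∀ n : Fin H, |f n - g n| ≤ if (n : ℕ) < c ∨ h ≤ n then (1 : ℝ) else 0 := by
    intro n
    split_ifs with hn
    · have := hf n
      have := hg n
      simp only [Set.mem_Icc] at *
      rw [abs_le]
      constructor <;> linarith
    · rw [hfg n (by omega) (by omega), sub_self, abs_zero]
  refine (Finset.sum_le_sum fun n _ => h1 n).trans ?_
  rw [← Finset.sum_range (fun n => if n < c ∨ h ≤ n then (1 : ℝ) else 0), Finset.sum_boole]
  have h2 : (Finset.range H).filter (fun n => n < c ∨ h ≤ n) ⊆
      Finset.range c ∪ Finset.Ico h H := by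
    intro n
    simp only [Finset.mem_filter, Finset.mem_range, Finset.mem_union, Finset.mem_Ico]
    omega
  have h3 := (Finset.card_le_card h2).trans (Finset.card_union_le _ _)
  rw [Finset.card_range, Nat.card_Ico] at h3
  exact_mod_cast h3.trans hB

section Column

variable {K q : ℕ} {w : ℕ → Fin K}

theorem ite_mem_Icc (p : Prop) [Decidable p] : (if p then (1 : ℝ) else 0) ∈ Set.Icc (0 : ℝ) 1 := by
  split_ifs <;> simp

/-- The height of the columns. -/
def height (q m : ℕ) : ℕ := (m / q + 2) * q

theorem lt_height (hq : 0 < q) (m : ℕ) {c : ℕ} (hc : c < q) : m + c ≤ height q m := by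
  have h1 := Nat.div_add_mod m q
  have h2 := Nat.mod_lt m hq
  have h3 : height q m = q * (m / q) + 2 * q := by rw [height]; ring
  omega

theorem height_le (q m : ℕ) : height q m ≤ m + 2 * q := by
  have h1 := Nat.div_mul_le_self m q
  rw [height, add_mul]
  omega

/-- The cycle of length `m + c` in a column. -/
def columnPerm (hq : 0 < q) {m : ℕ} (hm : 0 < m) {c : ℕ} (hc : c < q) :
    Equiv.Perm (Fin (height q m)) :=
  Fin.cycleRange ⟨m + c - 1, by have := lt_height hq m hc; omega⟩

variable (hq : 0 < q) {m : ℕ} (hm : 0 < m) {c : ℕ} (hc : c < q)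

/-- The cycle advances by one below its last point `m + c - 1`; the remaining positions number at
most 3q. -/
theorem abs_sum_column_one_sub_le (hw : Function.Periodic w q) (i j : Fin K) :
    |(∑ n : Fin (height q m), if w n = i ∧ w (columnPerm hq hm hc n) = j then (1 : ℝ) else 0) -
      (m / q + 2 : ℕ) * ∑ n ∈ Finset.range q, if w n = i ∧ w (n + 1) = j then (1 : ℝ) else 0|
      ≤ (3 * q : ℕ) := by
  have hper : Function.Periodic
      (fun n => if w n = i ∧ w (n + 1) = j then (1 : ℝ) else 0) q := fun n => by
    simp only [add_right_comm n q 1, hw n, hw (n + 1)]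
  rw [← sum_range_mul_of_periodic hper, ← height]
  have hH := lt_height hq m hc
  have hH' := height_le q m
  refine abs_sum_sub_sum_le (H := height q m) (B := 3 * q) (c := 0) (h := m + c - 1) _ _ (fun n => ite_mem_Icc _)
    (fun n => ite_mem_Icc _) (fun n _ hn => ?_) (by omega)
  have h1 := cycleRange_pow_of_lt (h := m + c) (by omega) hH (t := 1) (n := n) (by omega)
  rw [pow_one] at h1
  rw [columnPerm, h1]

theorem abs_sum_column_pow_sub_le (hw : Function.Periodic w q) (i j : Fin K) :
    |(∑ n : Fin (height q m), if w n = i ∧ w ((columnPerm hq hm hc ^ m) n) = j then (1 : ℝ) else 0) -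
      (m / q + 2 : ℕ) * ∑ n ∈ Finset.range q, if w n = i ∧ w (n + (q - c)) = j then (1 : ℝ) else 0|
      ≤ (3 * q : ℕ) := by
  have hper : Function.Periodic
      (fun n => if w n = i ∧ w (n + (q - c)) = j then (1 : ℝ) else 0) q := fun n => by
    simp only [add_right_comm n q (q - c), hw n, hw (n + (q - c))]
  rw [← sum_range_mul_of_periodic hper, ← height]
  have hH := lt_height hq m hc
  have hH' := height_le q m
  refine abs_sum_sub_sum_le (H := height q m) (B := 3 * q) (c := c) (h := m + c) _ _ (fun n => ite_mem_Icc _)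
    (fun n => ite_mem_Icc _) (fun n hcn hn => ?_) (by omega)
  have h1 := cycleRange_pow_sub (h := m + c) (by omega) hH hcn hn
  rw [Nat.add_sub_cancel] at h1
  -- Adding a period replaces the backward move by c with a forward move by q - c, avoiding
  -- truncated subtraction.
  have h2 : w (n - c) = w (n + (q - c)) := by
    rw [← hw (n - c)]
    congr 1
    omega
  rw [columnPerm, h1, h2]

end Column

section Columns

variable {K q : ℕ} {w : ℕ → Fin K}

theorem sum_shift_zero (hw : Function.Periodic w q)
    (hlab : ∀ i, (∑ n ∈ Finset.range q, if w n = i then (1 : ℝ) else 0) = q / K) (i j : Fin K) :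
    (∑ n ∈ Finset.range q, if w n = i ∧ w (n + (q - 0)) = j then (1 : ℝ) else 0) =
      if i = j then (q : ℝ) / K else 0 := by
  have h : ∀ n, w (n + (q - 0)) = w n := fun n => hw n
  simp only [h]
  split_ifs with hij
  · subst hij
    simpa using hlab i
  · refine Finset.sum_eq_zero fun n _ => if_neg ?_
    rintro ⟨rfl, rfl⟩
    exact hij rfl

theorem sum_range_shift {φ : ℕ → ℝ} (hφ : Function.Periodic φ q) (a : ℕ) :
    ∑ n ∈ Finset.range q, φ (a + n) = ∑ n ∈ Finset.range q, φ n := by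
  induction a with
  | zero => simp
  | succ a ih =>
    rw [← ih]
    have h1 := Finset.sum_range_succ (fun n => φ (a + n)) q
    have h2 := Finset.sum_range_succ' (fun n => φ (a + n)) q
    rw [h1, hφ a, add_zero] at h2
    rw [add_right_cancel h2]
    exact Finset.sum_congr rfl fun n _ => by congr 1; ring

/-- For fixed n, as c runs over a period the second position runs over a full period, so the second
letter is equidistributed whatever the first one is. This is the source of the independent part. -/
theorem sum_sum_shift (hw : Function.Periodic w q)
    (hlab : ∀ i, (∑ n ∈ Finset.range q, if w n = i then (1 : ℝ) else 0) = q / K) (i j : Fin K) :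
    (∑ c ∈ Finset.range q, ∑ n ∈ Finset.range q,
      if w n = i ∧ w (n + (q - c)) = j then (1 : ℝ) else 0) = q / K * (q / K) := by
  rw [Finset.sum_comm]
  have hφ : Function.Periodic (fun n => if w n = j then (1 : ℝ) else 0) q := fun n => by
    simp only [hw n]
  have h1 : ∀ n, (∑ c ∈ Finset.range q, if w n = i ∧ w (n + (q - c)) = j then (1 : ℝ) else 0) =
      (if w n = i then (1 : ℝ) else 0) * (q / K) := by
    intro n
    rw [← hlab j, ← sum_range_shift hφ (n + 1), ← Finset.sum_range_reflect (fun t =>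
      if w (n + 1 + t) = j then (1 : ℝ) else 0), Finset.mul_sum]
    refine Finset.sum_congr rfl fun c hc => ?_
    have hc := Finset.mem_range.1 hc
    have h2 : n + (q - c) = n + 1 + (q - 1 - c) := by omega
    rw [h2]
    split_ifs <;> simp_all
  simp only [h1]
  rw [← Finset.sum_mul, hlab]

/-- The shift of a column. -/
def shift (u : ℕ) {v q : ℕ} (z : Fin v × Fin q) : ℕ := if (z.1 : ℕ) < u then z.2 else 0

theorem shift_lt (u : ℕ) {v q : ℕ} (z : Fin v × Fin q) : shift u z < q := by
  rw [shift]
  split_ifs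
  · exact z.2.2
  · exact z.2.pos

theorem sum_shift {u v : ℕ} (huv : u ≤ v) (Q : ℕ → ℝ) :
    ∑ z : Fin v × Fin q, Q (shift u z) =
      u * ∑ c ∈ Finset.range q, Q c + (v - u) * (q * Q 0) := by
  rw [Fintype.sum_prod_type]
  have h1 : ∀ x : Fin v, ∑ y : Fin q, Q (shift u (x, y)) =
      (fun x : ℕ => if x < u then ∑ c ∈ Finset.range q, Q c else q * Q 0) x := by
    intro x
    simp only [shift]
    split_ifs with hx
    · rw [Finset.sum_range]
    · simp
  simp only [h1]
  rw [← Finset.sum_range (fun x : ℕ => if x < u then ∑ c ∈ Finset.range q, Q c else q * Q 0)]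
  obtain ⟨d, rfl⟩ := Nat.exists_eq_add_of_le huv
  rw [Finset.sum_range_add, Finset.sum_congr rfl fun x hx => if_pos (Finset.mem_range.1 hx)]
  simp

theorem prodCongrRight_pow {Z Y : Type*} (e : Z → Equiv.Perm Y) (t : ℕ) (a : Z × Y) :
    ((Equiv.prodCongrRight e : Equiv.Perm (Z × Y)) ^ t) a = (a.1, (e a.1 ^ t) a.2) := by
  induction t with
  | zero => rfl
  | succ t ih =>
    rw [pow_succ', Equiv.Perm.mul_apply, ih, pow_succ', Equiv.Perm.mul_apply]
    rfl

end Columns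

/-- Any doubly stochastic matrix is approximated by the transitions of a finite permutation with
equidistributed labels, whose `m`-th power is close to a prescribed mixture of the identity and of
the uniform transition. -/
theorem exists_perm {K : ℕ} (hK : 0 < K) {M : Matrix (Fin K) (Fin K) ℝ}
    (hM : M ∈ doublyStochastic ℝ (Fin K)) {ε : ℝ} (hε : 0 < ε) {c : ℝ}
    (hc : c ∈ Set.Icc (0 : ℝ) 1) :
    ∃ m₀ : ℕ, ∀ m ≥ m₀, ∃ (F : Type) (_ : Fintype F) (_ : Nonempty F) (σ : Equiv.Perm F)
      (ℓ : F → Fin K), (∀ i, (Finset.univ.filter fun a => ℓ a = i).card * K = Fintype.card F) ∧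
      ∀ i j, |((Finset.univ.filter fun a => ℓ a = i ∧ ℓ ((σ ^ 1) a) = j).card : ℝ) /
          Fintype.card F - M i j / K| ≤ ε ∧
        |((Finset.univ.filter fun a => ℓ a = i ∧ ℓ ((σ ^ m) a) = j).card : ℝ) / Fintype.card F -
          ((1 - c) * (if i = j then 1 / (K : ℝ) else 0) + c * (1 / K * (1 / K)))| ≤ ε := by
  obtain ⟨q, w, hq, hw, hlab, hpair⟩ := exists_word hK hM (half_pos hε)
  have hK' : (0 : ℝ) < K := by exact_mod_cast hK
  have hq' : (0 : ℝ) < q := by exact_mod_cast hq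
  -- Of the v groups of q columns, u = ⌊cv⌋ use every shift once and the others use shift 0; this v
  -- makes |u/v - c| at most ε/4.
  obtain ⟨v, hv⟩ := exists_nat_gt (4 / ε)
  have hv' : (0 : ℝ) < v := lt_trans (by positivity) hv
  have hv0 : 0 < v := by exact_mod_cast hv'
  let u := ⌊c * v⌋₊
  have hu1 : (u : ℝ) ≤ c * v := Nat.floor_le (mul_nonneg hc.1 hv'.le)
  have hu2 : c * v < u + 1 := Nat.lt_floor_add_one _
  have huv' : (u : ℝ) ≤ v := hu1.trans (mul_le_of_le_one_left hv'.le hc.2)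
  have huv : u ≤ v := by exact_mod_cast huv'
  -- Each column has height at least m, so the 3q bad positions are at most a proportion ε/2 of it.
  obtain ⟨m₀, hm₀⟩ := exists_nat_gt (6 * q / ε)
  refine ⟨m₀, fun m hmm => ?_⟩
  have hm' : 6 * q / ε < m := hm₀.trans_le (by exact_mod_cast hmm)
  have hm0' : (0 : ℝ) < m := lt_trans (by positivity) hm'
  have hm : 0 < m := by exact_mod_cast hm0'
  let A : ℕ := m / q + 2
  have hA : (0 : ℝ) < A := by positivity
  have hH : height q m = A * q := rfl
  have hHm : (m : ℝ) ≤ A * q := by exact_mod_cast (lt_height hq m hq : m + 0 ≤ height q m)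
  have hcardF : Fintype.card ((Fin v × Fin q) × Fin (height q m)) = v * q * (A * q) := by simp [hH]
  have hneF : Nonempty ((Fin v × Fin q) × Fin (height q m)) := by
    rw [← Fintype.card_pos_iff, hcardF]
    positivity
  let e : Fin v × Fin q → Equiv.Perm (Fin (height q m)) := fun z => columnPerm hq hm (shift_lt u z)
  let σ : Equiv.Perm ((Fin v × Fin q) × Fin (height q m)) := Equiv.prodCongrRight e
  let ℓ : ((Fin v × Fin q) × Fin (height q m)) → Fin K := fun a => w a.2
  have hcount : ∀ (t : ℕ) (i j : Fin K),
      ((Finset.univ.filter fun a => ℓ a = i ∧ ℓ ((σ ^ t) a) = j).card : ℝ) =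
        ∑ z : Fin v × Fin q, ∑ n : Fin (height q m), if w n = i ∧ w ((e z ^ t) n) = j then (1 : ℝ) else 0 := by
    intro t i j
    rw [← Finset.sum_boole, Fintype.sum_prod_type]
    simp only [ℓ, σ, prodCongrRight_pow]
  -- replacing column sums by sums over one period
  have hcompare : ∀ (X Y : Fin v × Fin q → ℝ), (∀ z, |X z - A * Y z| ≤ (3 * q : ℕ)) →
      |(∑ z, X z) / Fintype.card ((Fin v × Fin q) × Fin (height q m)) -
        (∑ z, Y z) / (v * q * q)| ≤ ε / 2 := by
    intro X Y hXY
    have h1 : (∑ z, X z) / Fintype.card ((Fin v × Fin q) × Fin (height q m)) -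
        (∑ z, Y z) / (v * q * q) =
        (∑ z, (X z - A * Y z)) / (v * q * (A * q)) := by
      rw [hcardF, Finset.sum_sub_distrib, ← Finset.mul_sum]
      push_cast
      field_simp
    rw [h1, abs_div, abs_of_pos (by positivity : (0 : ℝ) < v * q * (A * q)),
      div_le_iff₀ (by positivity)]
    have h2 : |∑ z, (X z - A * Y z)| ≤ v * q * (3 * q) := by
      refine (Finset.abs_sum_le_sum_abs _ _).trans
        ((Finset.sum_le_sum fun z _ => hXY z).trans (le_of_eq ?_))
      simp
    have h3 : 3 * q ≤ ε / 2 * (A * q) := by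
      rw [div_lt_iff₀ hε] at hm'
      have : ε * m ≤ ε * (A * q) := mul_le_mul_of_nonneg_left hHm hε.le
      linarith
    calc |∑ z, (X z - A * Y z)| ≤ v * q * (3 * q) := h2
      _ ≤ v * q * (ε / 2 * (A * q)) := mul_le_mul_of_nonneg_left h3 (by positivity)
      _ = ε / 2 * (v * q * (A * q)) := by ring
  refine ⟨((Fin v × Fin q) × Fin (height q m)), inferInstance, hneF, σ, ℓ, fun i => ?_, fun i j => ⟨?_, ?_⟩⟩
  · have h1 : ((Finset.univ.filter fun a => ℓ a = i).card : ℝ) = v * q * (A * (q / K)) := by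
      have hper : Function.Periodic (fun n => if w n = i then (1 : ℝ) else 0) q := fun n => by
        simp only [hw n]
      have h0 : (∑ n : Fin (height q m), if w n = i then (1 : ℝ) else 0) = A * (q / K) := by
        rw [← Finset.sum_range (fun n => if w n = i then (1 : ℝ) else 0), hH,
          sum_range_mul_of_periodic hper, hlab]
      rw [← Finset.sum_boole, Fintype.sum_prod_type]
      refine (Finset.sum_congr rfl fun z _ => h0).trans ?_
      simp
    have h2 : (((Finset.univ.filter fun a => ℓ a = i).card * K : ℕ) : ℝ) = (Fintype.card ((Fin v × Fin q) × Fin (height q m)) : ℕ) := by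
      push_cast
      rw [h1, hcardF]
      push_cast
      field_simp
    exact_mod_cast h2
  · rw [hcount]
    have h1 := hcompare _ _ fun z => by
      simpa only [pow_one] using abs_sum_column_one_sub_le hq hm (shift_lt u z) hw i j
    have h2 := hpair i j
    rw [Finset.sum_const, Finset.card_univ] at h1
    have h3 : ∀ P : ℝ, Fintype.card (Fin v × Fin q) • P / (v * q * q) = P / q := by
      intro P
      simp
      field_simp
    rw [h3] at h1
    simp only [pow_one] at h1 ⊢
    exact (abs_sub_le _ _ _).trans ((add_le_add h1 h2).trans_eq (add_halves ε))
  · rw [hcount]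
    have h1 := hcompare _ _ fun z => abs_sum_column_pow_sub_le hq hm (shift_lt u z) hw i j
    rw [sum_shift huv fun c => ∑ n ∈ Finset.range q,
      if w n = i ∧ w (n + (q - c)) = j then (1 : ℝ) else 0, sum_sum_shift hw hlab,
      sum_shift_zero hw hlab] at h1
    set δ : ℝ := if i = j then 1 / (K : ℝ) else 0
    have hδ : (if i = j then (q : ℝ) / K else 0) = q * δ := by
      simp only [δ]
      split_ifs <;> ring
    -- Over whole periods the columns give exactly the mixture with weight u/v, so only the rounding
    -- of c remains.
    have h2 : (u * ((q : ℝ) / K * (q / K)) + (v - u) * (q * (q * δ))) / (v * q * q) -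
        ((1 - c) * δ + c * (1 / K * (1 / K))) = (u / v - c) * (1 / K * (1 / K) - δ) := by
      field_simp
      ring
    have hK1 : 1 / (K : ℝ) ≤ 1 := (div_le_one hK').2 (by exact_mod_cast hK)
    have hK0 : 0 ≤ 1 / (K : ℝ) := by positivity
    have h3 : |(u / v - c) * (1 / K * (1 / K) - δ)| ≤ ε / 2 := by
      rw [abs_mul]
      have h4 : |(u : ℝ) / v - c| ≤ ε / 4 := by
        have h5 : (u : ℝ) / v - c = (u - c * v) / v := by field_simp
        rw [h5, abs_div, abs_of_pos hv', div_le_iff₀ hv', abs_le]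
        rw [div_lt_iff₀ hε] at hv
        constructor <;> linarith
      have h6 : |1 / (K : ℝ) * (1 / K) - δ| ≤ 1 := by
        have h7 : 1 / (K : ℝ) * (1 / K) ≤ 1 := by nlinarith
        have h8 : 0 ≤ 1 / (K : ℝ) * (1 / K) := by positivity
        have h9 : 0 ≤ δ ∧ δ ≤ 1 := by
          simp only [δ]
          split_ifs
          · exact ⟨hK0, hK1⟩
          · exact ⟨le_rfl, zero_le_one⟩
        rw [abs_le]
        constructor <;> linarith [h9.1, h9.2]
      calc _ ≤ ε / 4 * 1 := mul_le_mul h4 h6 (abs_nonneg _) (by positivity)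
        _ ≤ ε / 2 := by linarith
    rw [hδ] at h1
    rw [← h2] at h3
    exact (abs_sub_le _ _ _).trans ((add_le_add h1 h3).trans_eq (add_halves ε))

end PeriodicWord

/-! ### Imitating an arbitrary transformation on a grid. -/

theorem sum_measureReal_inter_gridCell {K : ℕ} (hK : 0 < K) {g : unitInterval → unitInterval}
    (hg : MeasurePreserving g volume volume) {A : Set unitInterval} (hA : MeasurableSet A) :
    ∑ j : Fin K, (volume : Measure unitInterval).real (A ∩ g ⁻¹' gridCell K j) =
      (volume : Measure unitInterval).real A := by
  rw [← measureReal_iUnion_fintype (f := fun j : Fin K => A ∩ g ⁻¹' gridCell K j)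
    (fun i j hij => ?_) fun j => hA.inter (hg.measurable (measurableSet_gridCell K j))]
  · refine congrArg ENNReal.toReal (measure_congr ?_)
    filter_upwards [hg.quasiMeasurePreserving.ae ae_lt_one] with x hx
    refine propext ⟨fun h => ?_, fun h => ?_⟩
    · obtain ⟨j, hj⟩ := Set.mem_iUnion.1 h
      exact hj.1
    · exact Set.mem_iUnion.2 ⟨⟨_, floor_lt hK hx⟩, h, rfl⟩
  · exact ((disjoint_gridCell K (Fin.val_injective.ne hij)).preimage g).mono
      Set.inter_subset_right Set.inter_subset_right

namespace MeasureAut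

theorem correlation_one_eq {α : Type*} [MeasurableSpace α] {μ : Measure α} (T : MeasureAut μ)
    (A B : Set α) : T.correlation 1 A B = μ.real (A ∩ T.rep.toEquiv ⁻¹' B) := by
  conv_lhs => rw [← mk_rep T]
  rfl

/-- Row sums use that the preimages of the cells partition the space almost everywhere; column sums
use that T preserves measure. -/
theorem correlation_mem_doublyStochastic {K : ℕ} (hK : 0 < K)
    (T : MeasureAut (volume : Measure unitInterval)) :
    (Matrix.of fun i j : Fin K => K * T.correlation 1 (gridCell K i) (gridCell K j)) ∈
      doublyStochastic ℝ (Fin K) := by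
  have hK' : (K : ℝ) ≠ 0 := by exact_mod_cast hK.ne'
  rw [mem_doublyStochastic_iff_sum]
  simp only [Matrix.of_apply, correlation_one_eq, ← Finset.mul_sum]
  refine ⟨fun i j => by positivity, fun i => ?_, fun j => ?_⟩
  · rw [sum_measureReal_inter_gridCell hK T.rep.measurePreserving (measurableSet_gridCell K i),
      measureReal_gridCell i.2, mul_one_div_cancel hK']
  · have h := sum_measureReal_inter_gridCell hK (MeasurePreserving.id volume)
      (T.rep.measurePreserving.measurable (measurableSet_gridCell K j))
    simp only [Set.preimage_id, Set.inter_comm _ (gridCell K _)] at h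
    rw [h, measureReal_def, T.rep.measurePreserving.measure_preimage
      (measurableSet_gridCell K j).nullMeasurableSet, ← measureReal_def, measureReal_gridCell j.2,
      mul_one_div_cancel hK']

/-- On a finite grid, any transformation is imitated by one whose `m`-th power is close to a
prescribed mixture of identity and independence. -/
theorem exists_correlation_approx (T₀ : MeasureAut (volume : Measure unitInterval)) {K : ℕ}
    (hK : 0 < K) {ε : ℝ} (hε : 0 < ε) {c : ℝ} (hc : c ∈ Set.Icc (0 : ℝ) 1) :
    ∃ m₀ : ℕ, ∀ m ≥ m₀, ∃ T : MeasureAut (volume : Measure unitInterval), ∀ i j : Fin K,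
      |T.correlation 1 (gridCell K i) (gridCell K j) -
        T₀.correlation 1 (gridCell K i) (gridCell K j)| ≤ ε ∧
      |T.correlation m (gridCell K i) (gridCell K j) -
        ((1 - c) * (volume : Measure unitInterval).real (gridCell K i ∩ gridCell K j) +
          c * ((volume : Measure unitInterval).real (gridCell K i) *
            (volume : Measure unitInterval).real (gridCell K j)))| ≤ ε := by
  have hK' : (K : ℝ) ≠ 0 := by exact_mod_cast hK.ne'
  obtain ⟨m₀, h⟩ := PeriodicWord.exists_perm hK (correlation_mem_doublyStochastic hK T₀) hε hc
  refine ⟨m₀, fun m hm => ?_⟩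
  obtain ⟨F, _, _, σ, ℓ, hℓ, hF⟩ := h m hm
  obtain ⟨T, hT⟩ := GridPermutation.exists_correlation_eq σ ℓ hℓ
  refine ⟨T, fun i j => ⟨?_, ?_⟩⟩
  · have h1 := (hF i j).1
    rw [Matrix.of_apply, mul_div_cancel_left₀ _ hK'] at h1
    rw [hT]
    exact h1
  · have h1 : (volume : Measure unitInterval).real (gridCell K i ∩ gridCell K j) =
        if i = j then 1 / (K : ℝ) else 0 := by
      split_ifs with hij
      · rw [hij, Set.inter_self, measureReal_gridCell j.2]
      · rw [(disjoint_gridCell K (Fin.val_injective.ne hij)).inter_eq, measureReal_empty]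
    rw [hT, h1, measureReal_gridCell i.2, measureReal_gridCell j.2]
    exact (hF i j).2

end MeasureAut

/-! ### The target operator and the reduction to one fine dyadic level. -/

section Interpolation

variable {α : Type*} [MeasurableSpace α] (μ : Measure α) [IsFiniteMeasure μ]

/-- The operator `(1 - c) I + c P`, where `P f` is the constant `∫ f`. -/
noncomputable def interpolatingOperator (c : ℝ) : Lp ℂ 2 μ →L[ℂ] Lp ℂ 2 μ :=
  ((1 - c : ℝ) : ℂ) • ContinuousLinearMap.id ℂ _ +
    (c : ℂ) • (innerSL ℂ (indicatorConstLp 2 MeasurableSet.univ (measure_ne_top μ _)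
      (1 : ℂ))).smulRight (indicatorConstLp 2 MeasurableSet.univ (measure_ne_top μ _) (1 : ℂ))

theorem inner_interpolatingOperator (c : ℝ) {A B : Set α} (hA : MeasurableSet A)
    (hB : MeasurableSet B) :
    ⟪indicatorConstLp 2 hA (measure_ne_top μ A) (1 : ℂ),
      interpolatingOperator μ c (indicatorConstLp 2 hB (measure_ne_top μ B) (1 : ℂ))⟫_ℂ =
      (((1 - c) * μ.real (A ∩ B) + c * (μ.real A * μ.real B) : ℝ) : ℂ) := by
  simp only [interpolatingOperator, add_apply, smul_apply,
    ContinuousLinearMap.id_apply, ContinuousLinearMap.smulRight_apply, innerSL_apply_apply,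
    inner_add_right, inner_smul_right, L2.inner_indicatorConstLp_one_indicatorConstLp_one]
  simp
  left
  ring

variable {μ}

/-- The difference between the `n`-th power of a Koopman operator and the interpolating
operator. -/
noncomputable def interpolationError (T : MeasureAut μ) (n : ℕ) (c : ℝ) :
    Lp ℂ 2 μ →ₗ[ℂ] Lp ℂ 2 μ :=
  T.unitary.toLinearEquiv.toLinearMap ^ n - (interpolatingOperator μ c).toLinearMap

theorem interpolationError_apply (T : MeasureAut μ) (n : ℕ) (c : ℝ) (f : Lp ℂ 2 μ) :
    interpolationError T n c f = T.unitary^[n] f - interpolatingOperator μ c f := by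
  rw [interpolationError, LinearMap.sub_apply, Module.End.pow_apply]
  rfl

theorem inner_interpolationError (T : MeasureAut μ) (n : ℕ) (c : ℝ) {A B : Set α}
    (hA : MeasurableSet A) (hB : MeasurableSet B) :
    ⟪indicatorConstLp 2 hA (measure_ne_top μ A) (1 : ℂ),
      interpolationError T n c (indicatorConstLp 2 hB (measure_ne_top μ B) (1 : ℂ))⟫_ℂ =
      ((T.correlation n A B -
        ((1 - c) * μ.real (A ∩ B) + c * (μ.real A * μ.real B)) : ℝ) : ℂ) := by
  rw [interpolationError_apply, inner_sub_right, ← MeasureAut.correlation_eq_inner T n hA hB,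
    inner_interpolatingOperator, ← Complex.ofReal_sub]

theorem norm_interpolationError_le (T : MeasureAut μ) (n : ℕ) (c : ℝ) (f : Lp ℂ 2 μ) :
    ‖interpolationError T n c f‖ ≤ (1 + ‖interpolatingOperator μ c‖) * ‖f‖ := by
  have h : ‖T.unitary^[n] f‖ = ‖f‖ := by
    induction n with
    | zero => rfl
    | succ n ih => rw [Function.iterate_succ_apply', LinearIsometryEquiv.norm_map, ih]
  rw [interpolationError_apply, add_mul, one_mul]
  exact (norm_sub_le _ _).trans (add_le_add h.le (ContinuousLinearMap.le_opNorm _ _))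

end Interpolation

theorem cellIndicator_pow {M N : ℕ} (h : M ≤ N) (i : ℕ) :
    cellIndicator (2 ^ M) i =
      ∑ a ∈ (Finset.range (2 ^ N)).filter (fun a => a / 2 ^ (N - M) = i),
        cellIndicator (2 ^ N) a := by
  have h1 := cellIndicator_mul (K := 2 ^ M) (L := 2 ^ (N - M)) (by positivity) (by positivity) i
  rwa [← pow_add, Nat.add_sub_cancel' h] at h1

/-- Matrix coefficients at coarse dyadic levels are bounded by those at a fine level. -/
theorem norm_inner_cellIndicator_le
    (D : Lp ℂ 2 (volume : Measure unitInterval) →ₗ[ℂ] Lp ℂ 2 (volume : Measure unitInterval))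
    {N : ℕ} {δ : ℝ} (hδ : 0 ≤ δ)
    (h : ∀ i j : Fin (2 ^ N), ‖⟪cellIndicator (2 ^ N) i, D (cellIndicator (2 ^ N) j)⟫_ℂ‖ ≤ δ)
    {M M' : ℕ} (hM : M ≤ N) (hM' : M' ≤ N) (i j : ℕ) :
    ‖⟪cellIndicator (2 ^ M) i, D (cellIndicator (2 ^ M') j)⟫_ℂ‖ ≤ 4 ^ N * δ := by
  rw [cellIndicator_pow hM, cellIndicator_pow hM', map_sum, sum_inner]
  simp only [inner_sum]
  have hcard : ∀ (p : ℕ → Prop) [DecidablePred p],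
      (((Finset.range (2 ^ N)).filter p).card : ℝ) ≤ 2 ^ N := by
    intro p _
    have := Finset.card_filter_le (Finset.range (2 ^ N)) p
    rw [Finset.card_range] at this
    exact_mod_cast this
  refine (norm_sum_le_of_le (n := fun _ => 2 ^ N * δ) _ fun a ha => ?_).trans ?_
  · refine (norm_sum_le_of_le (n := fun _ => δ) _ fun b hb => ?_).trans ?_
    · exact h ⟨a, Finset.mem_range.1 (Finset.mem_filter.1 ha).1⟩
        ⟨b, Finset.mem_range.1 (Finset.mem_filter.1 hb).1⟩
    · rw [Finset.sum_const, nsmul_eq_mul]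
      exact mul_le_mul_of_nonneg_right (hcard _) hδ
  · rw [Finset.sum_const, nsmul_eq_mul]
    calc _ ≤ (2 : ℝ) ^ N * (2 ^ N * δ) := mul_le_mul_of_nonneg_right (hcard _) (by positivity)
      _ = 4 ^ N * δ := by rw [← mul_assoc, ← mul_pow]; norm_num

/-! ### The G_δ description and the density of the open sets. -/

namespace MeasureAut

/-- The defect of the interpolation property for two dyadic cells. -/
noncomputable def dyadicDefect (T : MeasureAut (volume : Measure unitInterval)) (n : ℕ) (c : ℝ)
    (p p' : ℕ × ℕ) : ℝ :=
  T.correlation n (gridCell (2 ^ p.1) p.2) (gridCell (2 ^ p'.1) p'.2) -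
    ((1 - c) * (volume : Measure unitInterval).real
      (gridCell (2 ^ p.1) p.2 ∩ gridCell (2 ^ p'.1) p'.2) +
    c * ((volume : Measure unitInterval).real (gridCell (2 ^ p.1) p.2) *
      (volume : Measure unitInterval).real (gridCell (2 ^ p'.1) p'.2)))

theorem inner_interpolationError_cellIndicator
    (T : MeasureAut (volume : Measure unitInterval)) (n : ℕ) (c : ℝ) (p p' : ℕ × ℕ) :
    ⟪cellIndicator (2 ^ p.1) p.2, interpolationError T n c (cellIndicator (2 ^ p'.1) p'.2)⟫_ℂ =
      (T.dyadicDefect n c p p' : ℂ) :=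
  inner_interpolationError T n c (measurableSet_gridCell _ _) (measurableSet_gridCell _ _)

/-- The finite set of indices of dyadic cells tested at stage `N`. -/
def dyadicBox (N : ℕ) : Finset (ℕ × ℕ) := Finset.range (N + 1) ×ˢ Finset.range (N + 1)

/-- The transformations whose `n`-th power interpolates up to `1 / (N + 1)` on the cells of
stage `N`. -/
def approxInterpolating (n : ℕ) (c : ℝ) (N : ℕ) :
    Set (MeasureAut (volume : Measure unitInterval)) :=
  {T | ∀ p ∈ dyadicBox N, ∀ p' ∈ dyadicBox N, |T.dyadicDefect n c p p'| < 1 / ((N : ℝ) + 1)}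

theorem isOpen_approxInterpolating (n : ℕ) (c : ℝ) (N : ℕ) :
    IsOpen (approxInterpolating n c N) := by
  have h : approxInterpolating n c N = ⋂ p ∈ dyadicBox N, ⋂ p' ∈ dyadicBox N,
      {T | |T.dyadicDefect n c p p'| < 1 / ((N : ℝ) + 1)} := by
    ext T
    simp [approxInterpolating]
  rw [h]
  refine isOpen_biInter_finset fun p _ => isOpen_biInter_finset fun p' _ => ?_
  refine isOpen_lt (Continuous.abs ?_) continuous_const
  exact (continuous_correlation n (measurableSet_gridCell _ _)
    (measurableSet_gridCell _ _)).sub continuous_const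

theorem eventually_mem_dyadicBox (p : ℕ × ℕ) : ∀ᶠ N in atTop, p ∈ dyadicBox N := by
  filter_upwards [eventually_ge_atTop (max p.1 p.2)] with N hN
  have h1 := (le_max_left p.1 p.2).trans hN
  have h2 := (le_max_right p.1 p.2).trans hN
  simp only [dyadicBox, Finset.mem_product, Finset.mem_range]
  omega

theorem interpolatingSet_eq_iInter (m : ℕ → ℕ) (c : ℝ) :
    interpolatingSet (volume : Measure unitInterval) m c =
      ⋂ N : ℕ, ⋂ k₀ : ℕ, ⋃ k ≥ k₀, approxInterpolating (m k) c N := by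
  ext T
  simp only [Set.mem_iInter, Set.mem_iUnion, exists_prop]
  constructor
  · rintro ⟨k, hk, hT⟩ N k₀
    have h1 : ∀ᶠ l in atTop, ∀ p ∈ dyadicBox N, ∀ p' ∈ dyadicBox N,
        |T.dyadicDefect (m (k l)) c p p'| < 1 / ((N : ℝ) + 1) := by
      rw [Finset.eventually_all]
      intro p _
      rw [Finset.eventually_all]
      intro p' _
      have h2 := hT _ _ (measurableSet_gridCell (2 ^ p.1) p.2)
        (measurableSet_gridCell (2 ^ p'.1) p'.2)
      have h3 := Metric.tendsto_nhds.1 h2 (1 / ((N : ℝ) + 1)) (by positivity)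
      filter_upwards [h3] with l hl
      exact hl
    obtain ⟨l, hl, hl'⟩ := (h1.and (eventually_ge_atTop k₀)).exists
    exact ⟨k l, le_trans hl' hk.le_apply, hl⟩
  · intro h
    -- Diagonal choice: the N-th index meets the stage-N conditions, and any fixed pair of cells is
    -- tested at all later stages.
    obtain ⟨φ, hφ, hφ'⟩ := extraction_forall_of_frequently
      (P := fun N k => T ∈ approxInterpolating (m k) c N)
      fun N => frequently_atTop.2 fun k₀ => h N k₀
    refine ⟨φ, hφ, fun A B hA hB => ?_⟩
    have h1 : Tendsto (fun l => ⟪indicatorConstLp 2 hA (measure_ne_top volume A) (1 : ℂ),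
        interpolationError T (m (φ l)) c
          (indicatorConstLp 2 hB (measure_ne_top volume B) (1 : ℂ))⟫_ℂ) atTop (𝓝 0) := by
      refine tendsto_inner_apply_zero_of_span_dense
        (fun l => norm_interpolationError_le T (m (φ l)) c) span_dyadicIndicators_dense ?_ _ _
      rintro _ ⟨p, rfl⟩ _ ⟨p', rfl⟩
      simp only [inner_interpolationError_cellIndicator]
      refine squeeze_zero_norm' ?_ tendsto_one_div_add_atTop_nhds_zero_nat
      filter_upwards [eventually_mem_dyadicBox p, eventually_mem_dyadicBox p'] with l hp hp'
      rw [Complex.norm_real]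
      exact (hφ' l p hp p' hp').le
    simp only [inner_interpolationError] at h1
    have h2 := (Complex.continuous_re.tendsto _).comp h1
    exact tendsto_sub_nhds_zero_iff.1 h2

theorem dense_iUnion_approxInterpolating {m : ℕ → ℕ} (hm : StrictMono m) {c : ℝ}
    (hc : c ∈ Set.Icc (0 : ℝ) 1) (N k₀ : ℕ) :
    Dense (⋃ k ≥ k₀, approxInterpolating (m k) c N) := by
  intro T₀
  -- Passing from level N + r to coarser cells costs a factor 4^(N + r), the number of pairs of fine
  -- cells. The 2 makes the bound strictly smaller than 1/(N + 1) even at r = 0.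
  let ε : ℕ → ℝ := fun r => 1 / (((N + r : ℕ) : ℝ) + 2) / 4 ^ (N + r)
  have hε : ∀ r, 0 < ε r := fun r => by positivity
  have hε' : ∀ r, 4 ^ (N + r) * ε r = 1 / (((N + r : ℕ) : ℝ) + 2) := fun r => by
    simp only [ε]
    field_simp
  have hex : ∀ r : ℕ, ∃ k ≥ k₀, ∃ T : MeasureAut (volume : Measure unitInterval),
      ∀ i j : Fin (2 ^ (N + r)),
      |T.correlation 1 (gridCell (2 ^ (N + r)) i) (gridCell (2 ^ (N + r)) j) -
        T₀.correlation 1 (gridCell (2 ^ (N + r)) i) (gridCell (2 ^ (N + r)) j)| ≤ ε r ∧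
      |T.dyadicDefect (m k) c (N + r, i) (N + r, j)| ≤ ε r := by
    intro r
    obtain ⟨m₀, h⟩ := exists_correlation_approx T₀ (K := 2 ^ (N + r)) (by positivity) (hε r) hc
    -- Strict monotonicity gives `k ≤ m k`, so this index makes the exponent at least m₀.
    obtain ⟨T, hT⟩ := h (m (max k₀ m₀)) ((le_max_right _ _).trans hm.le_apply)
    exact ⟨max k₀ m₀, le_max_left _ _, T, hT⟩
  choose k hk T hT using hex
  refine mem_closure_of_tendsto (f := T) (b := atTop) ?_ (Eventually.of_forall fun r => ?_)
  · refine tendsto_of_tendsto_inner span_dyadicIndicators_dense ?_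
    rintro _ ⟨p, rfl⟩ _ ⟨p', rfl⟩
    rw [← tendsto_sub_nhds_zero_iff]
    refine squeeze_zero_norm' (a := fun r : ℕ => 1 / (((N + r : ℕ) : ℝ) + 2)) ?_ ?_
    · filter_upwards [eventually_ge_atTop (max p.1 p'.1)] with r hr
      have h1 := (le_max_left p.1 p'.1).trans hr
      have h2 := (le_max_right p.1 p'.1).trans hr
      rw [← hε', ← inner_sub_right]
      refine norm_inner_cellIndicator_le ((T r).unitary.toLinearEquiv.toLinearMap -
        T₀.unitary.toLinearEquiv.toLinearMap) (hε r).le (fun i j => ?_) (by omega) (by omega)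
        p.2 p'.2
      have h3 := correlation_eq_inner (T r) 1 (measurableSet_gridCell (2 ^ (N + r)) i)
        (measurableSet_gridCell (2 ^ (N + r)) j)
      have h4 := correlation_eq_inner T₀ 1 (measurableSet_gridCell (2 ^ (N + r)) i)
        (measurableSet_gridCell (2 ^ (N + r)) j)
      rw [Function.iterate_one] at h3 h4
      rw [LinearMap.sub_apply, inner_sub_right]
      change ‖⟪indicatorConstLp 2 (measurableSet_gridCell (2 ^ (N + r)) i) _ (1 : ℂ),
        (T r).unitary (indicatorConstLp 2 (measurableSet_gridCell (2 ^ (N + r)) j) _ (1 : ℂ))⟫_ℂ -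
        ⟪indicatorConstLp 2 (measurableSet_gridCell (2 ^ (N + r)) i) _ (1 : ℂ),
        T₀.unitary (indicatorConstLp 2 (measurableSet_gridCell (2 ^ (N + r)) j) _ (1 : ℂ))⟫_ℂ‖ ≤ _
      rw [← h3, ← h4, ← Complex.ofReal_sub, Complex.norm_real]
      exact (hT r i j).1
    · have h1 : Tendsto (fun r : ℕ => 1 / ((r : ℝ) + 1)) atTop (𝓝 0) :=
        tendsto_one_div_add_atTop_nhds_zero_nat
      refine ((h1.comp (tendsto_add_atTop_nat (N + 1))).congr fun r => ?_)
      simp only [Function.comp_apply]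
      push_cast
      congr 1
      ring
  · refine Set.mem_iUnion₂.2 ⟨k r, hk r, fun p hp p' hp' => ?_⟩
    simp only [dyadicBox, Finset.mem_product, Finset.mem_range] at hp hp'
    have h1 := norm_inner_cellIndicator_le (interpolationError (T r) (m (k r)) c) (hε r).le
      (fun i j => by
        rw [inner_interpolationError_cellIndicator (T r) (m (k r)) c (N + r, i) (N + r, j),
          Complex.norm_real]
        exact (hT r i j).2) (M := p.1) (M' := p'.1) (by omega) (by omega) p.2 p'.2
    rw [inner_interpolationError_cellIndicator, Complex.norm_real, hε'] at h1
    refine h1.trans_lt (one_div_lt_one_div_of_lt (by positivity) ?_)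
    push_cast
    linarith [(Nat.cast_nonneg r : (0 : ℝ) ≤ r)]

end MeasureAut

theorem corollary0 (m : ℕ → ℕ) (hm : StrictMono m) (lam : ℝ) (hlam : lam ∈ Set.Icc (0 : ℝ) 1) :
    Dense (MeasureAut.interpolatingSet (volume : Measure unitInterval) m lam) ∧
      IsGδ (MeasureAut.interpolatingSet (volume : Measure unitInterval) m lam) := by
  have hopen : ∀ N k₀ : ℕ, IsOpen (⋃ k ≥ k₀, MeasureAut.approxInterpolating (m k) lam N) :=
    fun N k₀ => isOpen_biUnion fun k _ => MeasureAut.isOpen_approxInterpolating (m k) lam N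
  rw [MeasureAut.interpolatingSet_eq_iInter]
  constructor
  · have := MeasureAut.baireSpace_unitInterval
    -- Baire's theorem needs a single countable family, so N and k₀ are combined into a pair.
    have h := dense_iInter_of_isOpen (fun x : ℕ × ℕ => hopen x.1 x.2) fun x =>
      MeasureAut.dense_iUnion_approxInterpolating hm hlam x.1 x.2
    exact h.mono fun T hT => Set.mem_iInter₂.2 fun N k₀ => Set.mem_iInter.1 hT (N, k₀)
  · exact IsGδ.iInter fun N => IsGδ.iInter fun k₀ => (hopen N k₀).isGδ
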